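/- Let $n\ge 2$, $\lambda=\frac{n-1}{2}$, and let $\mathcal S^n\subset\mathbb R^{n+1}$ be the unit sphere with surface measure $\sigma$ and Laplace--Beltrami operator $\Delta^\ast$. For a real function $f\in C^2(\mathcal S^n)$ with $\int_{\mathcal S^n}x\,|f(x)|^2\,d\sigma(x)\neq 0$ put $$ \mathrm{var}_S(f)=\left(\frac{\int_{\mathcal S^n}|f|^2\,d\sigma}{\left\|\int_{\mathcal S^n}x\,|f(x)|^2\,d\sigma(x)\right\|}\right)^2-1,\qquad \mathrm{var}_M(f)=-\frac{\int_{\mathcal S^n}\Delta^\ast f\cdot f\,d\sigma}{\int_{\mathcal S^n}|f|^2\,d\sigma},\qquad U(f)=\sqrt{\mathrm{var}_S(f)}\cdot\sqrt{\mathrm{var}_M(f)}. $$ Let $C_l^\lambda$ be the Gegenbauer polynomials, given by $\sum_{l\ge0}C_l^\lambda(t)\,r^l=(1-2tr+r^2)^{-\lambda}$. Let $a>0$, $c>0$, and let $q_\nu$ be a real polynomial of degree $\nu\ge1$ such that $q_\nu(l)>0$ for all integers $l\geq1$ and $q_\nu(l)\le q_\nu(m)$ for all integers $m\ge l\ge1$.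 For $\rho>0$ let $$ \Psi_\rho(x)=\sum_{l=0}^\infty\left[\rho^a q_\nu(l)\right]^c e^{-\rho^a q_\nu(l)}\,\frac{l+\lambda}{\lambda}\,C_l^\lambda(x_1),\qquad x=(x_1,\dots,x_{n+1})\in\mathcal S^n. $$ (If $q_\nu(0)<0$, the power in the term $l=0$ is read as the real part of its principal value, $y^c:=|y|^c\cos(\pi c)$ for $y<0$; this is the usual power when $c$ is an integer.) Then for every $\rho>0$ the series converges absolutely at every point of $\mathcal S^n$ and $\Psi_\rho\in C^2(\mathcal S^n)$; for all sufficiently small $\rho>0$, $\int_{\mathcal S^n}x\,|\Psi_\rho(x)|^2\,d\sigma(x)\ne0$; and, as $\rho\to0^+$, $$ \mathrm{var}_S(\Psi_\rho)=\mathcal O\!\left(\rho^{a/\nu}\right),\qquad \mathrm{var}_M(\Psi_\rho)=\mathcal O\!\left(\rho^{-2a/\nu}\right),\qquad U(\Psi_\rho)=\mathcal O\!\left(\rho^{-a/(2\nu)}\right). $$ -/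

import Mathlib

open MeasureTheory Filter Topology Asymptotics
open scoped Manifold ContDiff

noncomputable section

namespace SphericalWavelet

/-- The ambient Euclidean space `ℝ^{n+1}`. -/
abbrev Ambient (n : ℕ) : Type := EuclideanSpace ℝ (Fin (n + 1))

/-- The unit sphere `𝒮^n ⊆ ℝ^{n+1}`. -/
abbrev Sph (n : ℕ) : Type := Metric.sphere (0 : Ambient n) 1

/-- The (unnormalized) surface measure `σ` on `𝒮^n`. -/
def surf (n : ℕ) : Measure (Sph n) := (volume : Measure (Ambient n)).toSphere

/-- The extension of a function on `𝒮^n` to `ℝ^{n+1} ∖ {0}` that is constant along rays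
(with the irrelevant value `0` at the origin). -/
def radialExt {n : ℕ} (f : Sph n → ℝ) (y : Ambient n) : ℝ :=
  open Classical in
  if hy : y ≠ 0 then
    f ⟨‖y‖⁻¹ • y, by
      rw [mem_sphere_zero_iff_norm, norm_smul, norm_inv, norm_norm,
        inv_mul_cancel₀ (norm_ne_zero_iff.mpr hy)]⟩
  else 0

/-- The Laplace–Beltrami operator `Δ*` on `𝒮^n`: the Euclidean Laplacian of the extension that is
constant along rays, evaluated on the sphere. -/
def laplaceBeltrami {n : ℕ} (f : Sph n → ℝ) (x : Sph n) : ℝ :=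
  Laplacian.laplacian (radialExt f) (x : Ambient n)

/-- The vector `∫ x |f(x)|² dσ(x) ∈ ℝ^{n+1}`. -/
def firstMoment {n : ℕ} (f : Sph n → ℝ) : Ambient n :=
  ∫ x, |f x| ^ 2 • (x : Ambient n) ∂(surf n)

/-- The variance in space domain; the square of a vector is the square of its Euclidean norm. -/
def varS {n : ℕ} (f : Sph n → ℝ) : ℝ :=
  ((∫ x, |f x| ^ 2 ∂(surf n)) / ‖firstMoment f‖) ^ 2 - 1

/-- The variance in momentum domain. -/
def varM {n : ℕ} (f : Sph n → ℝ) : ℝ :=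
  -((∫ x, laplaceBeltrami f x * f x ∂(surf n)) / ∫ x, |f x| ^ 2 ∂(surf n))

/-- The uncertainty product. -/
def uncertaintyProduct {n : ℕ} (f : Sph n → ℝ) : ℝ :=
  √(varS f) * √(varM f)

/-- The Gegenbauer polynomial `C_l^lam`, evaluated at `t`: the coefficient of `r^l` in the power
series of the generating function `r ↦ (1 - 2tr + r²)^{-lam}` at `r = 0`. -/
def gegenbauer (lam : ℝ) (l : ℕ) (t : ℝ) : ℝ :=
  iteratedDeriv l (fun r : ℝ => (1 - 2 * t * r + r ^ 2) ^ (-lam)) 0 / (l.factorial : ℝ)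

/-- `λ = (n - 1) / 2`. -/
def order (n : ℕ) : ℝ := ((n : ℝ) - 1) / 2

/-- The Gegenbauer coefficients `[ρ^a q(l)]^c e^{-ρ^a q(l)} (l + λ) / λ`. -/
def waveletCoeff (n : ℕ) (a c : ℝ) (q : Polynomial ℝ) (ρ : ℝ) (l : ℕ) : ℝ :=
  (ρ ^ a * q.eval (l : ℝ)) ^ c * Real.exp (-(ρ ^ a * q.eval (l : ℝ))) *
    (((l : ℝ) + order n) / order n)

/-- The `l`-th term of the Gegenbauer expansion of the wavelet at `x`, where `x 0` is the first
coordinate `cos ϑ` of `x`. -/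
def waveletTerm (n : ℕ) (a c : ℝ) (q : Polynomial ℝ) (ρ : ℝ) (x : Sph n) (l : ℕ) : ℝ :=
  waveletCoeff n a c q ρ l * gegenbauer (order n) l ((x : Ambient n) 0)

/-- The zonal wavelet `Ψ_ρ` on `𝒮^n`. -/
def wavelet (n : ℕ) (a c : ℝ) (q : Polynomial ℝ) (ρ : ℝ) (x : Sph n) : ℝ :=
  ∑' l : ℕ, waveletTerm n a c q ρ x l

end SphericalWavelet

end

noncomputable section

namespace SphericalWavelet

/-! Write h_l for the squared norm of C_l^λ(x_1) on the sphere, w_l = y^c e^{-y} at y = ρ^a q(l),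
and δ = ρ^{a/ν}, so that ρ^a q(l) is comparable to (δl)^ν for l ≥ 1. The coefficients of Ψ_ρ are w_l
(l+λ)/λ.

The key is an exact formula. With W_l = 2 h_0 binom(l+n-1, n-1), the norm formula gives λ²(W_l +
W_{l-1}) = 2(l+λ)² h_l, and the three-term recurrence turns multiplication by x_1 into a shift of l.
Hence ∫|Ψ|² = Σ W_l (w_l² + w_{l+1}²)/2 and ∫ x_1|Ψ|² = Σ W_l w_l w_{l+1}
(`hasSum_integral_sq_zonalSeries`, `hasSum_integral_coord_mul_sq_zonalSeries`), so the defect ∫|Ψ|²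
- ∫ x_1|Ψ|² is Σ W_l (w_l - w_{l+1})²/2.

Since W_l grows like l^{n-1}, the mass is at least of order δ^{-n} (`exists_mass_bound`). In the
defect one factor |w_l - w_{l+1}| is bounded and the other is summed as a weighted variation, which
gives O(δ^{1-n}) (`exists_variation_bound`). The energy -∫ Δ*Ψ·Ψ has the extra eigenvalue l(l+2λ)
and is O(δ^{-n-2}) (`exists_energy_bound`). Dividing by the mass, the relative defect is O(δ), hence
so is var_S, and var_M is O(δ^{-2}); the bound for U is the product of the square roots.

The analytic input is that the coefficients decay geometrically in l. On a Bernstein ellipse around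
[-1, 1] the polynomial C_l^λ is at most R^l C_l^λ(1), so the series is holomorphic near [-1, 1] and
may be differentiated and integrated term by term. -/

open Polynomial in
/-- The Gegenbauer polynomials, defined by their three-term recurrence. -/
def gegenbauerPoly (lam : ℝ) : ℕ → Polynomial ℝ
  | 0 => 1
  | 1 => C (2 * lam) * X
  | l + 2 => C ((l : ℝ) + 2)⁻¹ * (C (2 * ((l : ℝ) + 1 + lam)) * X * gegenbauerPoly lam (l + 1)
      - C ((l : ℝ) + 2 * lam) * gegenbauerPoly lam l)

/-! ### Recurrences and differential equation of the Gegenbauer polynomials -/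

section Algebra

open Polynomial

theorem gegenbauerPoly_recurrence (lam : ℝ) (l : ℕ) :
    C ((l : ℝ) + 2) * gegenbauerPoly lam (l + 2) =
      C (2 * ((l : ℝ) + 1 + lam)) * X * gegenbauerPoly lam (l + 1)
        - C ((l : ℝ) + 2 * lam) * gegenbauerPoly lam l := by
  have h : ((l : ℝ) + 2) ≠ 0 := by positivity
  rw [gegenbauerPoly, ← mul_assoc, ← C_mul, mul_inv_cancel₀ h, C_1, one_mul]

/-- The relations need a joint induction: the differentiated recurrence and the first relation at
`l` give the second at `l + 1`, from which the first at `l + 1` follows. -/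
theorem derivative_gegenbauerPoly_relations (lam : ℝ) (l : ℕ) :
    X * derivative (gegenbauerPoly lam (l + 1)) - derivative (gegenbauerPoly lam l) =
        C ((l : ℝ) + 1) * gegenbauerPoly lam (l + 1) ∧
      derivative (gegenbauerPoly lam (l + 1)) - X * derivative (gegenbauerPoly lam l) =
        C ((l : ℝ) + 2 * lam) * gegenbauerPoly lam l := by
  induction l with
  | zero => constructor <;> simp [gegenbauerPoly, mul_comm]
  | succ l ih =>
    obtain ⟨h₁, h₂⟩ := ih
    have hr := gegenbauerPoly_recurrence lam l
    have hd := congrArg derivative hr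
    simp only [derivative_mul, derivative_sub, derivative_C, derivative_X, zero_mul, zero_add,
      mul_one] at hd
    have hC : (C ((l : ℝ) + 2) : ℝ[X]) ≠ 0 := by
      rw [Ne, C_eq_zero]; positivity
    simp only [C_add, C_mul, C_1, map_ofNat, Nat.cast_add, Nat.cast_one] at *
    have h₂' : derivative (gegenbauerPoly lam (l + 1 + 1)) -
        X * derivative (gegenbauerPoly lam (l + 1)) =
        (C (l : ℝ) + 1 + 2 * C lam) * gegenbauerPoly lam (l + 1) := by
      refine mul_left_cancel₀ hC ?_
      linear_combination hd + (C (l : ℝ) + 2 * C lam) * h₁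
    refine ⟨?_, h₂'⟩
    linear_combination X * h₂' - hr + X * h₁ - h₂

/-- Eliminating the derivative of C_l between the two relations expresses (1 - X²)C'_{l+1} through
C_l and C_{l+1}; one more differentiation closes the system. -/
theorem gegenbauerPoly_ode (lam : ℝ) (l : ℕ) :
    (1 - X ^ 2) * derivative (derivative (gegenbauerPoly lam l))
        - C (2 * lam + 1) * X * derivative (gegenbauerPoly lam l)
      = - C ((l : ℝ) * (l + 2 * lam)) * gegenbauerPoly lam l := by
  cases l with
  | zero => simp [gegenbauerPoly]
  | succ l =>
    obtain ⟨h₁, h₂⟩ := derivative_gegenbauerPoly_relations lam l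
    have h₃ : (1 - X ^ 2) * derivative (gegenbauerPoly lam (l + 1)) =
        C ((l : ℝ) + 2 * lam) * gegenbauerPoly lam l
          - C ((l : ℝ) + 1) * X * gegenbauerPoly lam (l + 1) := by
      linear_combination h₂ - X * h₁
    have hd := congrArg derivative h₃
    simp only [derivative_mul, derivative_sub, derivative_C, derivative_X, derivative_one,
      derivative_X_pow, zero_mul, zero_add, mul_one] at hd
    simp only [C_add, C_mul, C_1, map_ofNat, Nat.cast_add, Nat.cast_one, pow_one,
      Nat.add_one_sub_one, Nat.cast_ofNat] at *
    linear_combination hd - (C (l : ℝ) + 2 * C lam) * h₁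

end Algebra

/-! ### Generating function, and growth of the polynomials on complex ellipses -/

section GeneratingFunction

open PowerSeries

/-- A power series that solves the differential equation of the generating function has the
Gegenbauer polynomials as its coefficients. -/
theorem coeff_eq_aeval_gegenbauerPoly {K : Type*} [Field K] [Algebra ℝ K] (lam : ℝ) (t : K)
    (E : PowerSeries K) (h0 : coeff 0 E = 1)
    (hE : (1 - C (2 * t) * X + X ^ 2) * d⁄dX K E
      = C (2 * algebraMap ℝ K lam) * (C t - X) * E) (l : ℕ) :
    coeff l E = Polynomial.aeval t (gegenbauerPoly lam l) := by
  have hK : CharZero K := charZero_of_injective_algebraMap (algebraMap ℝ K).injective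
  have h1 : coeff 1 E = 2 * algebraMap ℝ K lam * t := by
    have := congrArg (coeff 0) hE
    simp only [coeff_zero_eq_constantCoeff, map_mul, map_add, map_sub, map_one, constantCoeff_C,
      constantCoeff_X, mul_zero, sub_zero, map_pow, zero_pow two_ne_zero, add_zero, one_mul] at this
    rw [← coeff_zero_eq_constantCoeff_apply, coeff_derivative, 
      ← coeff_zero_eq_constantCoeff_apply, h0] at this
    simpa using this
  have hrec (l : ℕ) : ((l : K) + 2) * coeff (l + 2) E =
      2 * ((l : K) + 1 + algebraMap ℝ K lam) * t * coeff (l + 1) E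
        - ((l : K) + 2 * algebraMap ℝ K lam) * coeff l E := by
    have hE' : d⁄dX K E - C (2 * t) * (X * d⁄dX K E) + X * (X * d⁄dX K E) =
        C (2 * algebraMap ℝ K lam) * (C t * E - X * E) := by
      linear_combination hE
    have hX (k : ℕ) : coeff k (X * d⁄dX K E) = k * coeff k E := by
      cases k with
      | zero => simp
      | succ k => rw [coeff_succ_X_mul, coeff_derivative]; push_cast; ring
    have := congrArg (coeff (l + 1)) hE'
    simp only [map_add, map_sub, coeff_C_mul, coeff_succ_X_mul, hX, coeff_derivative] at this
    push_cast at this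
    linear_combination this
  induction l using Nat.strong_induction_on with
  | _ l ih =>
    match l with
    | 0 => simpa [gegenbauerPoly] using h0
    | 1 => simpa [gegenbauerPoly, map_ofNat] using h1
    | l + 2 =>
      have hl : (l : K) + 2 ≠ 0 := by exact_mod_cast (Nat.succ_ne_zero (l + 1))
      have hr := congrArg (Polynomial.aeval t) (gegenbauerPoly_recurrence lam l)
      simp only [map_mul, map_sub, map_add, Polynomial.aeval_C, Polynomial.aeval_X, map_natCast,
        map_ofNat, map_one] at hr
      refine mul_left_cancel₀ hl ?_
      rw [hrec, hr, ih _ (by omega), ih _ (by omega)]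

/-- The Taylor series at `0`. -/
def taylorAtZero (f : ℝ → ℝ) : PowerSeries ℝ :=
  PowerSeries.mk fun k => iteratedDeriv k f 0 / (k.factorial : ℝ)

theorem taylorAtZero_mul {f g : ℝ → ℝ} (hf : ContDiffAt ℝ ∞ f 0) (hg : ContDiffAt ℝ ∞ g 0) :
    taylorAtZero (f * g) = taylorAtZero f * taylorAtZero g := by
  ext k
  rw [coeff_mul, Finset.Nat.sum_antidiagonal_eq_sum_range_succ_mk]
  simp only [taylorAtZero, coeff_mk]
  rw [iteratedDeriv_mul (hf.of_le (by exact_mod_cast le_top)) (hg.of_le (by exact_mod_cast le_top)),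
    Finset.sum_div]
  refine Finset.sum_congr rfl fun i hi => ?_
  have hik : i ≤ k := by simpa [Nat.lt_succ_iff] using hi
  rw [Nat.cast_choose ℝ hik]
  have := Nat.factorial_ne_zero k
  field_simp

theorem taylorAtZero_deriv (f : ℝ → ℝ) : taylorAtZero (deriv f) = d⁄dX ℝ (taylorAtZero f) := by
  ext k
  rw [coeff_derivative]
  simp only [taylorAtZero, coeff_mk, iteratedDeriv_succ', Nat.factorial_succ]
  push_cast
  field_simp

theorem taylorAtZero_congr {f g : ℝ → ℝ} (h : f =ᶠ[𝓝 0] g) :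
    taylorAtZero f = taylorAtZero g := by
  ext k
  simp only [taylorAtZero, coeff_mk, h.iteratedDeriv_eq]

theorem taylorAtZero_quadratic (u v w : ℝ) :
    taylorAtZero (fun r => u + v * r + w * r ^ 2) = C u + C v * X + C w * X ^ 2 := by
  have h1 : deriv (fun r : ℝ => u + v * r + w * r ^ 2) = fun r => v + 2 * w * r := by
    funext r
    have : HasDerivAt (fun r : ℝ => u + v * r + w * r ^ 2) (0 + v * 1 + w * (2 * r ^ 1 * 1)) r :=
      (((hasDerivAt_const r u).add ((hasDerivAt_id r).const_mul v)).add
        (((hasDerivAt_id r).pow 2).const_mul w))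
    rw [this.deriv]; ring
  have h2 : deriv (fun r : ℝ => v + 2 * w * r) = fun _ => 2 * w := by
    funext r
    have : HasDerivAt (fun r : ℝ => v + 2 * w * r) (0 + 2 * w * 1) r :=
      ((hasDerivAt_const r v).add ((hasDerivAt_id r).const_mul (2 * w)))
    rw [this.deriv]; ring
  ext k
  simp only [taylorAtZero, coeff_mk]
  match k with
  | 0 => simp
  | 1 => simp [h1, coeff_X_pow]
  | 2 => simp [iteratedDeriv_succ', h1, h2, coeff_X_pow]
  | k + 3 =>
    rw [iteratedDeriv_succ', h1, iteratedDeriv_succ', h2, iteratedDeriv_succ']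
    simp [coeff_X_pow]

/-- The generating function satisfies (1 - 2tr + r²)G' = 2λ(t - r)G near r = 0. Passing to Taylor
series turns this into the formal equation that determines the coefficients. -/
theorem gegenbauer_eq_eval (lam : ℝ) (l : ℕ) (t : ℝ) :
    gegenbauer lam l t = (gegenbauerPoly lam l).eval t := by
  set G : ℝ → ℝ := fun r => (1 - 2 * t * r + r ^ 2) ^ (-lam) with hG
  have hpoly (u v w : ℝ) : ContDiffAt ℝ ∞ (fun r : ℝ => u + v * r + w * r ^ 2) 0 := by fun_prop
  have hne : ∀ᶠ r : ℝ in 𝓝 0, 0 < 1 - 2 * t * r + r ^ 2 := by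
    have : ContinuousAt (fun r : ℝ => 1 - 2 * t * r + r ^ 2) 0 := by fun_prop
    exact this.eventually (lt_mem_nhds (by simp))
  have hGs : ContDiffAt ℝ ∞ G 0 := by
    refine ContDiffAt.rpow_const_of_ne (by fun_prop) (by simp)
  have hGd : ContDiffAt ℝ ∞ (deriv G) 0 := by
    have := hGs.fderiv_right (m := ∞) (by simp)
    exact this.clm_apply contDiffAt_const
  have hode : ((fun r : ℝ => 1 + (-(2 * t)) * r + 1 * r ^ 2) * deriv G) =ᶠ[𝓝 0]
      ((fun r : ℝ => 2 * lam * t + (-(2 * lam)) * r + 0 * r ^ 2) * G) := by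
    filter_upwards [hne] with r hr
    have hp : HasDerivAt (fun r : ℝ => 1 - 2 * t * r + r ^ 2) (-(2 * t) + 2 * r) r := by
      simpa using
        (((hasDerivAt_id' r).const_mul (2 * t)).const_sub 1).fun_add ((hasDerivAt_id' r).fun_pow 2)
    have := hp.rpow_const (p := -lam) (Or.inl hr.ne')
    simp only [Pi.mul_apply, hG, this.deriv]
    rw [Real.rpow_sub_one hr.ne']
    field_simp
    ring
  have hE := taylorAtZero_congr hode
  rw [taylorAtZero_mul (hpoly _ _ _) hGd, taylorAtZero_mul (hpoly _ _ _) hGs, taylorAtZero_deriv,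
    taylorAtZero_quadratic, taylorAtZero_quadratic] at hE
  have := coeff_eq_aeval_gegenbauerPoly lam t (taylorAtZero G) (by simp [taylorAtZero, hG]) (by
    simp only [map_neg, map_mul, map_one, map_zero, map_ofNat, Algebra.algebraMap_self,
      RingHom.id_apply] at hE ⊢
    linear_combination hE) l
  simpa [taylorAtZero, gegenbauer, Polynomial.aeval_def] using this

/-- The coefficients of `(1 - X) ^ (-lam)`. -/
def negBinomCoeff (lam : ℝ) : ℕ → ℝ
  | 0 => 1
  | j + 1 => (lam + j) / (j + 1) * negBinomCoeff lam j

theorem negBinomCoeff_nonneg {lam : ℝ} (h : 0 ≤ lam) (j : ℕ) : 0 ≤ negBinomCoeff lam j := by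
  induction j with
  | zero => simp [negBinomCoeff]
  | succ j ih => rw [negBinomCoeff]; positivity

/-- For t = (z + z⁻¹)/2 the quadratic 1 - 2tX + X² factors as (1 - zX)(1 - z⁻¹X), so the generating
series is a product of two binomial series. The case z = 1 over ℝ and general z over ℂ are compared
later. -/
theorem aeval_gegenbauerPoly_joukowski {K : Type*} [Field K] [Algebra ℝ K] (lam : ℝ) {z : K}
    (hz : z ≠ 0) (l : ℕ) :
    Polynomial.aeval ((z + z⁻¹) / 2) (gegenbauerPoly lam l) =
      ∑ p ∈ Finset.HasAntidiagonal.antidiagonal l, algebraMap ℝ K (negBinomCoeff lam p.1) * z ^ p.1 *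
        (algebraMap ℝ K (negBinomCoeff lam p.2) * z⁻¹ ^ p.2) := by
  have hK : CharZero K := charZero_of_injective_algebraMap (algebraMap ℝ K).injective
  let B (y : K) : PowerSeries K :=
    PowerSeries.mk fun j => algebraMap ℝ K (negBinomCoeff lam j) * y ^ j
  have hB (y : K) : (1 - C y * X) * d⁄dX K (B y) = C (algebraMap ℝ K lam * y) * B y := by
    have hX (k : ℕ) : coeff k (X * d⁄dX K (B y)) = k * coeff k (B y) := by
      cases k with
      | zero => simp
      | succ k => rw [coeff_succ_X_mul, coeff_derivative]; push_cast; ring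
    ext k
    rw [sub_mul, one_mul, mul_assoc, map_sub, coeff_C_mul, hX, coeff_derivative, coeff_C_mul]
    simp only [B, coeff_mk, negBinomCoeff, map_mul, map_div₀, map_add, map_natCast, map_one]
    have : (k : K) + 1 ≠ 0 := by exact_mod_cast Nat.succ_ne_zero k
    field_simp
    ring
  have h2 : (2 : K) * ((z + z⁻¹) / 2) = z + z⁻¹ := by field_simp
  have hC : (C (2 * ((z + z⁻¹) / 2)) : PowerSeries K) = C z + C z⁻¹ := by rw [h2, map_add]
  have hCC : (C z : PowerSeries K) * C z⁻¹ = 1 := by rw [← map_mul, mul_inv_cancel₀ hz, map_one]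
  rw [← coeff_eq_aeval_gegenbauerPoly lam _ (B z * B z⁻¹) (by simp [B, negBinomCoeff])]
  · simp only [coeff_mul, B, coeff_mk]
  · have e1 := hB z
    have e2 := hB z⁻¹
    have hC' : (C (2 * algebraMap ℝ K lam) * C ((z + z⁻¹) / 2) : PowerSeries K) =
        C (algebraMap ℝ K lam) * (C z + C z⁻¹) := by
      rw [← map_mul, ← map_add, ← map_mul]; congr 1; field_simp
    rw [hC, mul_sub, hC', Derivation.leibniz, smul_eq_mul, smul_eq_mul]
    simp only [map_mul, map_ofNat] at e1 e2 ⊢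
    linear_combination (1 - C z⁻¹ * X) * B z⁻¹ * e1 + (1 - C z * X) * B z * e2
      + (X ^ 2 * (- (B z * d⁄dX K (B z⁻¹) + B z⁻¹ * d⁄dX K (B z)))
        - 2 * C (algebraMap ℝ K lam) * X * B z * B z⁻¹) * hCC

/-- At X = 1 the two derivative relations have the same left side. -/
theorem eval_one_gegenbauerPoly_succ (lam : ℝ) (l : ℕ) :
    ((l : ℝ) + 1) * (gegenbauerPoly lam (l + 1)).eval 1 =
      ((l : ℝ) + 2 * lam) * (gegenbauerPoly lam l).eval 1 := by
  obtain ⟨h₁, h₂⟩ := derivative_gegenbauerPoly_relations lam l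
  have h₁' := congrArg (Polynomial.eval 1) h₁
  have h₂' := congrArg (Polynomial.eval 1) h₂
  simp only [Polynomial.eval_sub, Polynomial.eval_mul, Polynomial.eval_X, Polynomial.eval_C] at *
  linear_combination h₂' - h₁'

theorem eval_one_gegenbauerPoly_nonneg {lam : ℝ} (h : 0 ≤ lam) (l : ℕ) :
    0 ≤ (gegenbauerPoly lam l).eval 1 := by
  induction l with
  | zero => simp [gegenbauerPoly]
  | succ l ih =>
    have := eval_one_gegenbauerPoly_succ lam l
    have h' : 0 ≤ ((l : ℝ) + 1) * (gegenbauerPoly lam (l + 1)).eval 1 := by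
      rw [this]; positivity
    exact nonneg_of_mul_nonneg_right h' (by positivity)

theorem eval_one_gegenbauerPoly_le {lam : ℝ} (h : 0 ≤ lam) {m : ℕ} (hm : 2 * lam ≤ m + 1)
    (l : ℕ) : (gegenbauerPoly lam l).eval 1 ≤ ((l : ℝ) + 1) ^ m := by
  induction l with
  | zero => simp [gegenbauerPoly]
  | succ l ih =>
    have hl : (0 : ℝ) < (l : ℝ) + 1 := by positivity
    have hp := eval_one_gegenbauerPoly_nonneg h l
    -- Bernoulli's inequality bounds the growth ratio (l + 2λ)/(l + 1) by ((l + 2)/(l + 1))^m.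
    have hb : 1 + (m : ℝ) * (1 / ((l : ℝ) + 1)) ≤ (1 + 1 / ((l : ℝ) + 1)) ^ m :=
      one_add_mul_le_pow (by have : 0 ≤ 1 / ((l : ℝ) + 1) := by positivity
                             linarith) m
    have h1 : (l : ℝ) + 2 * lam ≤ ((l : ℝ) + 1) * (1 + 1 / ((l : ℝ) + 1)) ^ m := by
      refine le_trans ?_ (mul_le_mul_of_nonneg_left hb hl.le)
      field_simp
      linarith
    have h2 : ((l : ℝ) + 1 + 1) ^ m = (1 + 1 / ((l : ℝ) + 1)) ^ m * ((l : ℝ) + 1) ^ m := by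
      rw [← mul_pow]; congr 1; field_simp
    refine le_of_mul_le_mul_left ?_ hl
    rw [eval_one_gegenbauerPoly_succ]
    push_cast
    rw [h2, ← mul_assoc]
    exact mul_le_mul h1 ih hp (by positivity)

/-- The open ellipse with foci `±1` and semi-axes `(R ± R⁻¹) / 2`. -/
def bernsteinEllipse (R : ℝ) : Set ℂ := {t | ‖t - 1‖ + ‖t + 1‖ < R + R⁻¹}

theorem isOpen_bernsteinEllipse (R : ℝ) : IsOpen (bernsteinEllipse R) :=
  isOpen_lt (by fun_prop) continuous_const

theorem ofReal_mem_bernsteinEllipse {R t : ℝ} (hR : 1 < R) (ht : |t| ≤ 1) :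
    (t : ℂ) ∈ bernsteinEllipse R := by
  obtain ⟨h1, h2⟩ := abs_le.mp ht
  have e1 : ‖(t : ℂ) - 1‖ = 1 - t := by
    rw [← Complex.ofReal_one, ← Complex.ofReal_sub, Complex.norm_real, Real.norm_eq_abs,
      abs_of_nonpos (by linarith)]; ring
  have e2 : ‖(t : ℂ) + 1‖ = t + 1 := by
    rw [← Complex.ofReal_one, ← Complex.ofReal_add, Complex.norm_real, Real.norm_eq_abs,
      abs_of_nonneg (by linarith)]
  rw [bernsteinEllipse, Set.mem_ofPred_eq, e1, e2]
  have : 0 < (R - 1) ^ 2 / R := by have : 0 < R - 1 := by linarith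
                                   positivity
  have e3 : (R - 1) ^ 2 / R = R + R⁻¹ - 2 := by field_simp; ring
  linarith

/-- Take z = t + √(t² - 1). Then |t ∓ 1| = |z ∓ 1|²/(2|z|), and the parallelogram law gives |t - 1|
+ |t + 1| = |z| + |z|⁻¹, which is below R + R⁻¹ only for |z| between R⁻¹ and R. -/
theorem exists_joukowski_of_mem_bernsteinEllipse {R : ℝ} (hR : 1 < R) {t : ℂ}
    (ht : t ∈ bernsteinEllipse R) :
    ∃ z : ℂ, z ≠ 0 ∧ (z + z⁻¹) / 2 = t ∧ ‖z‖ ≤ R ∧ ‖z⁻¹‖ ≤ R := by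
  obtain ⟨s, hs⟩ := IsAlgClosed.exists_pow_nat_eq (t ^ 2 - 1) (n := 2) (by norm_num)
  have hz1 : (t + s) * (t - s) = 1 := by linear_combination -hs
  have hz0 : t + s ≠ 0 := left_ne_zero_of_mul_eq_one hz1
  have hinv : (t + s)⁻¹ = t - s := inv_eq_of_mul_eq_one_right hz1
  refine ⟨t + s, hz0, by rw [hinv]; ring, ?_⟩
  set z := t + s with hz
  have htz : t = (z + z⁻¹) / 2 := by rw [hinv]; ring
  have hzpos : 0 < ‖z‖ := norm_pos_iff.mpr hz0
  have e1 : ‖t - 1‖ = ‖z - 1‖ ^ 2 / (2 * ‖z‖) := by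
    rw [← norm_pow, show (2 : ℝ) * ‖z‖ = ‖2 * z‖ by simp, ← norm_div]
    congr 1; rw [htz]; field_simp; ring
  have e2 : ‖t + 1‖ = ‖z + 1‖ ^ 2 / (2 * ‖z‖) := by
    rw [← norm_pow, show (2 : ℝ) * ‖z‖ = ‖2 * z‖ by simp, ← norm_div]
    congr 1; rw [htz]; field_simp; ring
  have hpar := parallelogram_law_with_norm ℝ z 1
  have hsum : ‖t - 1‖ + ‖t + 1‖ = ‖z‖ + ‖z‖⁻¹ := by
    rw [e1, e2]
    field_simp
    rw [norm_one] at hpar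
    linarith
  rw [bernsteinEllipse, Set.mem_ofPred_eq, hsum] at ht
  have hprod : (‖z‖ - R) * (‖z‖ - R⁻¹) < 0 := by
    have : ‖z‖ * (‖z‖ + ‖z‖⁻¹) < ‖z‖ * (R + R⁻¹) := mul_lt_mul_of_pos_left ht hzpos
    have h3 : ‖z‖ * ‖z‖⁻¹ = 1 := mul_inv_cancel₀ hzpos.ne'
    have h4 : R * R⁻¹ = 1 := mul_inv_cancel₀ (by positivity)
    nlinarith
  have hRinv : R⁻¹ < R := (inv_lt_one_of_one_lt₀ hR).trans hR
  rcases mul_neg_iff.mp hprod with ⟨h1, h2⟩ | ⟨h1, h2⟩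
  · linarith
  · refine ⟨by linarith, ?_⟩
    rw [norm_inv]
    exact inv_le_of_inv_le₀ (by linarith) (by linarith)

theorem norm_aeval_gegenbauerPoly_le {lam R : ℝ} (hlam : 0 ≤ lam) (hR : 1 < R) {t : ℂ}
    (ht : t ∈ bernsteinEllipse R) (l : ℕ) :
    ‖Polynomial.aeval t (gegenbauerPoly lam l)‖ ≤ R ^ l * (gegenbauerPoly lam l).eval 1 := by
  obtain ⟨z, hz0, rfl, hz1, hz2⟩ := exists_joukowski_of_mem_bernsteinEllipse hR ht
  -- At z = 1 the same sum, with nonnegative coefficients, is C_l(1); it dominates the sum at z up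
  -- to R^l.
  have h1 := aeval_gegenbauerPoly_joukowski lam (one_ne_zero : (1 : ℝ) ≠ 0) l
  norm_num [Polynomial.aeval_def] at h1
  rw [aeval_gegenbauerPoly_joukowski lam hz0, h1, Finset.mul_sum]
  refine (norm_sum_le _ _).trans (Finset.sum_le_sum fun p hp => ?_)
  have ha := negBinomCoeff_nonneg hlam p.1
  have hb := negBinomCoeff_nonneg hlam p.2
  rw [← Finset.HasAntidiagonal.mem_antidiagonal.mp hp, pow_add, norm_mul, norm_mul, norm_mul, norm_pow, norm_pow]
  simp only [Complex.coe_algebraMap, Complex.norm_real, Real.norm_eq_abs, abs_of_nonneg ha,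
    abs_of_nonneg hb]
  calc negBinomCoeff lam p.1 * ‖z‖ ^ p.1 * (negBinomCoeff lam p.2 * ‖z⁻¹‖ ^ p.2)
      ≤ negBinomCoeff lam p.1 * R ^ p.1 * (negBinomCoeff lam p.2 * R ^ p.2) := by gcongr
    _ = _ := by ring

end GeneratingFunction

/-! ### Moments of the first coordinate on the sphere, by Gaussian integrals -/

section Moments

theorem integrable_pow_mul_exp_neg_sq (k : ℕ) :
    Integrable fun t : ℝ => t ^ k * Real.exp (-t ^ 2) := by
  have h : (-1 : ℝ) < k := by have : (0 : ℝ) ≤ k := by positivity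
                              linarith
  simpa using integrable_rpow_mul_exp_neg_mul_sq one_pos h

theorem hasDerivAt_exp_neg_sq (t : ℝ) :
    HasDerivAt (fun t : ℝ => Real.exp (-t ^ 2)) (Real.exp (-t ^ 2) * (-(2 * t))) t := by
  simpa using ((hasDerivAt_id' t).fun_pow 2).fun_neg.exp

theorem integral_mul_exp_neg_sq : ∫ t : ℝ, t ^ 1 * Real.exp (-t ^ 2) = 0 := by
  have h := integral_eq_zero_of_hasDerivAt_of_integrable hasDerivAt_exp_neg_sq
    (((integrable_pow_mul_exp_neg_sq 1).const_mul (-2)).congr (ae_of_all _ fun t => by ring))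
    (by simpa using integrable_pow_mul_exp_neg_sq 0)
  have h' : ∫ t : ℝ, (-2) * (t ^ 1 * Real.exp (-t ^ 2)) = 0 := by
    rw [← h]; congr 1; ext t; ring
  rw [integral_const_mul] at h'
  linarith

theorem integral_pow_add_two_mul_exp_neg_sq (k : ℕ) :
    2 * ∫ t : ℝ, t ^ (k + 2) * Real.exp (-t ^ 2) =
      ((k : ℝ) + 1) * ∫ t : ℝ, t ^ k * Real.exp (-t ^ 2) := by
  have hd (t : ℝ) : HasDerivAt (fun t : ℝ => t ^ (k + 1) * Real.exp (-t ^ 2))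
      (((k : ℝ) + 1) * (t ^ k * Real.exp (-t ^ 2)) - 2 * (t ^ (k + 2) * Real.exp (-t ^ 2))) t := by
    have := ((hasDerivAt_id' t).fun_pow (k + 1)).fun_mul (hasDerivAt_exp_neg_sq t)
    refine this.congr_deriv ?_
    rw [Nat.add_sub_cancel]
    push_cast
    ring
  have h := integral_eq_zero_of_hasDerivAt_of_integrable hd
    (((integrable_pow_mul_exp_neg_sq k).const_mul _).sub
      ((integrable_pow_mul_exp_neg_sq (k + 2)).const_mul _)) (integrable_pow_mul_exp_neg_sq (k + 1))
  rw [integral_sub ((integrable_pow_mul_exp_neg_sq k).const_mul _)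
      ((integrable_pow_mul_exp_neg_sq (k + 2)).const_mul _), integral_const_mul,
    integral_const_mul] at h
  linarith

theorem integral_Ioi_pow_mul_exp_neg_sq (k : ℕ) :
    ∫ r in Set.Ioi (0 : ℝ), r ^ k * Real.exp (-r ^ 2) = 1 / 2 * Real.Gamma (((k : ℝ) + 1) / 2) := by
  have h : (-1 : ℝ) < k := by have : (0 : ℝ) ≤ k := by positivity
                              linarith
  simpa using integral_rpow_mul_exp_neg_rpow (p := 2) (q := k) two_pos h

theorem integral_Ioi_pow_mul_exp_neg_sq_pos (k : ℕ) :
    0 < ∫ r in Set.Ioi (0 : ℝ), r ^ k * Real.exp (-r ^ 2) := by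
  rw [integral_Ioi_pow_mul_exp_neg_sq]
  have : 0 < Real.Gamma (((k : ℝ) + 1) / 2) := Real.Gamma_pos_of_pos (by positivity)
  positivity

theorem integral_Ioi_pow_add_two_mul_exp_neg_sq (k : ℕ) :
    2 * ∫ r in Set.Ioi (0 : ℝ), r ^ (k + 2) * Real.exp (-r ^ 2) =
      ((k : ℝ) + 1) * ∫ r in Set.Ioi (0 : ℝ), r ^ k * Real.exp (-r ^ 2) := by
  rw [integral_Ioi_pow_mul_exp_neg_sq, integral_Ioi_pow_mul_exp_neg_sq]
  have h := Real.Gamma_add_one (s := ((k : ℝ) + 1) / 2) (by positivity)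
  rw [show ((k + 2 : ℕ) + 1 : ℝ) / 2 = ((k : ℝ) + 1) / 2 + 1 by push_cast; ring, h]
  ring

theorem integral_gaussian_moment_eq_prod (n k : ℕ) :
    ∫ y : Ambient n, y 0 ^ k * Real.exp (-‖y‖ ^ 2) =
      (∫ t : ℝ, t ^ k * Real.exp (-t ^ 2)) * (∫ t : ℝ, Real.exp (-t ^ 2)) ^ n := by
  rw [← (PiLp.volume_preserving_toLp (Fin (n + 1))).integral_comp
    (MeasurableEquiv.toLp 2 _).measurableEmbedding]
  let f : Fin (n + 1) → ℝ → ℝ :=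
    Fin.cons (fun t => t ^ k * Real.exp (-t ^ 2)) fun _ t => Real.exp (-t ^ 2)
  have h : ∀ v : Fin (n + 1) → ℝ, (WithLp.toLp 2 v : Ambient n) 0 ^ k *
      Real.exp (-‖(WithLp.toLp 2 v : Ambient n)‖ ^ 2) = ∏ i, f i (v i) := by
    intro v
    rw [EuclideanSpace.norm_sq_eq, Fin.prod_univ_succ, Fin.sum_univ_succ, neg_add, Real.exp_add,
      ← Finset.sum_neg_distrib, Real.exp_sum]
    simp [f, mul_assoc]
  simp_rw [h]
  rw [integral_fintype_prod_volume_eq_prod, Fin.prod_univ_succ]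
  simp [f]

/-- Compared with the Cartesian product formula for the same integral, this isolates the spherical
moment. -/
theorem integral_gaussian_moment_eq_polar (n k : ℕ) :
    ∫ y : Ambient n, y 0 ^ k * Real.exp (-‖y‖ ^ 2) =
      (∫ x : Sph n, (x : Ambient n) 0 ^ k ∂(surf n)) *
        ∫ r in Set.Ioi (0 : ℝ), r ^ (n + k) * Real.exp (-r ^ 2) := by
  have hdim : Module.finrank ℝ (Ambient n) - 1 = n := by simp
  calc
    _ = ∫ y : ({(0)}ᶜ : Set (Ambient n)), y.1 0 ^ k * Real.exp (-‖y.1‖ ^ 2)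
          ∂((volume : Measure (Ambient n)).comap (↑)) := by
      rw [integral_subtype_comap (measurableSet_singleton _).compl
        fun y : Ambient n => y 0 ^ k * Real.exp (-‖y‖ ^ 2), restrict_compl_singleton]
    _ = ∫ p : Sph n × Set.Ioi (0 : ℝ), (p.1 : Ambient n) 0 ^ k *
          ((p.2 : ℝ) ^ k * Real.exp (-(p.2 : ℝ) ^ 2))
          ∂(surf n).prod (.volumeIoiPow n) := by
      have := (volume : Measure (Ambient n)).measurePreserving_homeomorphUnitSphereProd.integral_comp
        (Homeomorph.measurableEmbedding _)
        (fun p : Sph n × Set.Ioi (0 : ℝ) => (p.1 : Ambient n) 0 ^ k *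
          ((p.2 : ℝ) ^ k * Real.exp (-(p.2 : ℝ) ^ 2)))
      rw [hdim] at this
      rw [surf, ← this]
      congr 1
      ext y
      have hy : ‖y.1‖ ≠ 0 := norm_ne_zero_iff.mpr y.2
      simp only [homeomorphUnitSphereProd_apply_snd_coe, homeomorphUnitSphereProd_apply_fst_coe,
        PiLp.smul_apply, smul_eq_mul]
      rw [← mul_assoc, ← mul_pow]
      congr 2
      field_simp
    _ = (∫ x : Sph n, (x : Ambient n) 0 ^ k ∂(surf n)) *
          ∫ r : Set.Ioi (0 : ℝ), (r : ℝ) ^ k * Real.exp (-(r : ℝ) ^ 2) ∂(.volumeIoiPow n) := by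
      have : SFinite (surf n) := by unfold surf; infer_instance
      exact integral_prod_mul (L := ℝ) (fun x : Sph n => (x : Ambient n) 0 ^ k)
        (fun r : Set.Ioi (0 : ℝ) => (r : ℝ) ^ k * Real.exp (-(r : ℝ) ^ 2))
    _ = _ := by
      congr 1
      simp only [Measure.volumeIoiPow, ENNReal.ofReal]
      rw [integral_withDensity_eq_integral_smul,
        integral_subtype_comap measurableSet_Ioi
          fun r : ℝ => Real.toNNReal (r ^ n) • (r ^ k * Real.exp (-r ^ 2)),
        setIntegral_congr_fun measurableSet_Ioi fun x hx => ?_]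
      · rw [NNReal.smul_def, Real.coe_toNNReal _ (pow_nonneg hx.out.le _), smul_eq_mul, pow_add,
          mul_assoc]
      · exact (measurable_subtype_coe.pow_const _).real_toNNReal

instance (n : ℕ) : IsFiniteMeasure (surf n) := by unfold surf; infer_instance

theorem integral_coord_sphere (n : ℕ) : ∫ x : Sph n, (x : Ambient n) 0 ^ 1 ∂(surf n) = 0 := by
  have h := (integral_gaussian_moment_eq_polar n 1).symm.trans (integral_gaussian_moment_eq_prod n 1)
  rw [integral_mul_exp_neg_sq, zero_mul] at h
  exact (mul_eq_zero.mp h).resolve_right (integral_Ioi_pow_mul_exp_neg_sq_pos _).ne'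

theorem integral_coord_pow_add_two_sphere (n k : ℕ) :
    ((n : ℝ) + k + 1) * ∫ x : Sph n, (x : Ambient n) 0 ^ (k + 2) ∂(surf n) =
      ((k : ℝ) + 1) * ∫ x : Sph n, (x : Ambient n) 0 ^ k ∂(surf n) := by
  have h₁ := (integral_gaussian_moment_eq_polar n k).symm.trans
    (integral_gaussian_moment_eq_prod n k)
  have h₂ := (integral_gaussian_moment_eq_polar n (k + 2)).symm.trans
    (integral_gaussian_moment_eq_prod n (k + 2))
  have hG := integral_pow_add_two_mul_exp_neg_sq k
  have hR := integral_Ioi_pow_add_two_mul_exp_neg_sq (n + k)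
  have hpos := integral_Ioi_pow_mul_exp_neg_sq_pos (n + k)
  rw [← add_assoc] at h₂
  push_cast at hR
  refine mul_right_cancel₀ hpos.ne' ?_
  generalize (∫ t : ℝ, Real.exp (-t ^ 2)) ^ n = g at *
  linear_combination 2 * h₂ - ((k : ℝ) + 1) * h₁ + g * hG -
    (∫ x : Sph n, (x : Ambient n) 0 ^ (k + 2) ∂(surf n)) * hR

theorem surf_univ_pos (n : ℕ) : 0 < ∫ _ : Sph n, (1 : ℝ) ∂(surf n) := by
  have h := (integral_gaussian_moment_eq_polar n 0).symm.trans (integral_gaussian_moment_eq_prod n 0)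
  have hg : 0 < ∫ t : ℝ, Real.exp (-t ^ 2) := by
    have := integral_gaussian 1
    simp only [neg_mul, one_mul, div_one] at this
    rw [this]; positivity
  simp only [pow_zero, one_mul, add_zero] at h
  have h' : 0 < (∫ _ : Sph n, (1 : ℝ) ∂(surf n)) *
      ∫ r in Set.Ioi (0 : ℝ), r ^ n * Real.exp (-r ^ 2) := by rw [h]; positivity
  exact pos_of_mul_pos_left h' (integral_Ioi_pow_mul_exp_neg_sq_pos n).le

end Moments

/-! ### Orthogonality and norms of the zonal Gegenbauer polynomials -/

section Orthogonality

open Polynomial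

theorem integrable_of_continuous_sphere {n : ℕ} {F : Type*} [NormedAddCommGroup F]
    {f : Sph n → F} (hf : Continuous f) : Integrable f (surf n) :=
  hf.integrable_of_hasCompactSupport (HasCompactSupport.of_compactSpace f)

theorem continuous_eval_coord (n : ℕ) (p : ℝ[X]) :
    Continuous fun x : Sph n => p.eval ((x : Ambient n) 0) :=
  p.continuous.comp (by fun_prop)

/-- The integral over the sphere of the zonal function with profile `p`. -/
def zonalIntegral (n : ℕ) : ℝ[X] →ₗ[ℝ] ℝ where
  toFun p := ∫ x : Sph n, p.eval ((x : Ambient n) 0) ∂(surf n)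
  map_add' p q := by
    simp only [eval_add]
    exact integral_add (integrable_of_continuous_sphere (continuous_eval_coord n p))
      (integrable_of_continuous_sphere (continuous_eval_coord n q))
  map_smul' a p := by
    simp only [eval_smul, smul_eq_mul, RingHom.id_apply]
    exact integral_const_mul _ _

/-- The integrand is (1 - t²)^{-(n-2)/2} times the derivative of (1 - t²)^{n/2} W, and zonal
integration has density proportional to (1 - t²)^{(n-2)/2}. On monomials the identity is just the
moment recursion. -/
theorem zonalIntegral_divergence (n : ℕ) (W : ℝ[X]) :
    zonalIntegral n ((1 - X ^ 2) * derivative W - C (n : ℝ) * X * W) = 0 := by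
  induction W using Polynomial.induction_on' with
  | add p q hp hq =>
    rw [← add_zero (0 : ℝ)]
    nth_rewrite 1 [← hp]
    rw [← hq, ← map_add]
    congr 1
    rw [derivative_add]
    ring
  | monomial k a =>
    match k with
    | 0 =>
      have : (1 - X ^ 2) * derivative (monomial 0 a) - C (n : ℝ) * X * monomial 0 a =
          (-(n * a)) • (X ^ 1 : ℝ[X]) := by
        rw [monomial_zero_left, derivative_C, smul_eq_C_mul]; simp; ring
      rw [this, map_smul]
      simp only [zonalIntegral, LinearMap.coe_mk, AddHom.coe_mk, eval_pow, eval_X,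
        integral_coord_sphere, smul_zero]
    | k + 1 =>
      have : (1 - X ^ 2) * derivative (monomial (k + 1) a) - C (n : ℝ) * X * monomial (k + 1) a =
          (a * (k + 1)) • (X ^ k : ℝ[X]) - (a * (n + k + 1)) • X ^ (k + 2) := by
        rw [derivative_monomial, ← C_mul_X_pow_eq_monomial, ← C_mul_X_pow_eq_monomial,
          smul_eq_C_mul, smul_eq_C_mul]
        simp only [C_mul, C_add, C_1, Nat.cast_add, Nat.cast_one, Nat.add_one_sub_one]
        ring
      rw [this, map_sub, map_smul, map_smul]
      simp only [zonalIntegral, LinearMap.coe_mk, AddHom.coe_mk, eval_pow, eval_X, smul_eq_mul]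
      linear_combination -a * integral_coord_pow_add_two_sphere n k

theorem two_mul_order (n : ℕ) : 2 * order n = n - 1 := by rw [order]; ring

theorem order_pos {n : ℕ} (hn : 2 ≤ n) : 0 < order n := by
  have : (2 : ℝ) ≤ n := by exact_mod_cast hn
  rw [order]; linarith

theorem zonalIntegral_gegenbauerPoly_mul_of_ne {n : ℕ} (hn : 2 ≤ n) {l m : ℕ} (hlm : l ≠ m) :
    zonalIntegral n (gegenbauerPoly (order n) l * gegenbauerPoly (order n) m) = 0 := by
  set P := gegenbauerPoly (order n)
  have hl := gegenbauerPoly_ode (order n) l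
  have hm := gegenbauerPoly_ode (order n) m
  rw [two_mul_order, sub_add_cancel] at hl hm
  -- Sturm–Liouville argument: the divergence of the Wronskian is the eigenvalue difference times
  -- the product.
  have hdiv := zonalIntegral_divergence n (P m * derivative (P l) - P l * derivative (P m))
  have hid : (1 - X ^ 2) * derivative (P m * derivative (P l) - P l * derivative (P m))
      - C (n : ℝ) * X * (P m * derivative (P l) - P l * derivative (P m)) =
      ((m : ℝ) * (m + 2 * order n) - l * (l + 2 * order n)) • (P l * P m) := by
    rw [derivative_sub, derivative_mul, derivative_mul, smul_eq_C_mul, C_sub, two_mul_order]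
    linear_combination P m * hl - P l * hm
  rw [hid, map_smul, smul_eq_mul, mul_eq_zero] at hdiv
  refine hdiv.resolve_left ?_
  have hpos := order_pos hn
  have : (m : ℝ) * (m + 2 * order n) - l * (l + 2 * order n) =
      ((m : ℝ) - l) * (m + l + 2 * order n) := by ring
  rw [this]
  exact mul_ne_zero (sub_ne_zero.mpr (by exact_mod_cast hlm.symm)) (by positivity)

/-- The squared norm of the zonal Gegenbauer polynomial of degree `l` on the sphere. -/
def gegenbauerSqNorm (n l : ℕ) : ℝ :=
  zonalIntegral n (gegenbauerPoly (order n) l * gegenbauerPoly (order n) l)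

/-- The integral of X C_l C_{l+1} is computed twice, by expanding X C_l and by expanding X C_{l+1}
with the recurrence; orthogonality leaves one norm each time. -/
theorem gegenbauerSqNorm_succ {n : ℕ} (hn : 2 ≤ n) (l : ℕ) :
    ((l : ℝ) + 1) * (l + 1 + order n) * gegenbauerSqNorm n (l + 1) =
      (l + order n) * (l + 2 * order n) * gegenbauerSqNorm n l := by
  set P := gegenbauerPoly (order n) with hP
  have h₁ : 2 * ((l : ℝ) + order n) * zonalIntegral n (X * P l * P (l + 1)) =
      (l + 1) * gegenbauerSqNorm n (l + 1) := by
    match l with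
    | 0 =>
      have e : (2 * order n) • (X * P 0 * P 1) = P 1 * P 1 := by
        rw [smul_eq_C_mul]; simp only [hP, gegenbauerPoly]; ring
      have := congrArg (zonalIntegral n) e
      rw [map_smul, smul_eq_mul] at this
      simpa [gegenbauerSqNorm] using this
    | l + 1 =>
      have e : (2 * ((l : ℝ) + 1 + order n)) • (X * P (l + 1) * P (l + 2)) =
          ((l : ℝ) + 2) • (P (l + 2) * P (l + 2)) + ((l : ℝ) + 2 * order n) • (P l * P (l + 2)) := by
        rw [smul_eq_C_mul, smul_eq_C_mul, smul_eq_C_mul]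
        linear_combination -P (l + 2) * gegenbauerPoly_recurrence (order n) l
      have := congrArg (zonalIntegral n) e
      rw [map_add, map_smul, map_smul, map_smul, smul_eq_mul, smul_eq_mul, smul_eq_mul,
        zonalIntegral_gegenbauerPoly_mul_of_ne hn (by omega : l ≠ l + 2)] at this
      rw [gegenbauerSqNorm]
      push_cast
      linear_combination this
  have h₂ : 2 * ((l : ℝ) + 1 + order n) * zonalIntegral n (X * P l * P (l + 1)) =
      (l + 2 * order n) * gegenbauerSqNorm n l := by
    have e : (2 * ((l : ℝ) + 1 + order n)) • (X * P l * P (l + 1)) =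
        ((l : ℝ) + 2) • (P (l + 2) * P l) + ((l : ℝ) + 2 * order n) • (P l * P l) := by
      rw [smul_eq_C_mul, smul_eq_C_mul, smul_eq_C_mul]
      linear_combination -P l * gegenbauerPoly_recurrence (order n) l
    have := congrArg (zonalIntegral n) e
    rw [map_add, map_smul, map_smul, map_smul, smul_eq_mul, smul_eq_mul, smul_eq_mul,
      zonalIntegral_gegenbauerPoly_mul_of_ne hn (by omega : l + 2 ≠ l)] at this
    rw [gegenbauerSqNorm]
    linear_combination this
  linear_combination (l + order n) * h₂ - ((l : ℝ) + 1 + order n) * h₁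

theorem gegenbauerSqNorm_eq {n : ℕ} (hn : 2 ≤ n) (l : ℕ) :
    (l + order n) * (l + 2 * order n) * gegenbauerSqNorm n l =
      2 * order n ^ 2 * gegenbauerSqNorm n 0 * ((l + n - 1).choose (n - 1) : ℝ) := by
  obtain ⟨m, rfl⟩ : ∃ m, n = m + 1 := ⟨n - 1, by omega⟩
  have e (l : ℕ) : l + (m + 1) - 1 = l + m := by omega
  simp only [e, Nat.add_sub_cancel]
  induction l with
  | zero =>
    rw [zero_add, Nat.choose_self]
    push_cast
    ring
  | succ l ih =>
    have h := gegenbauerSqNorm_succ hn l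
    have hl : (l : ℝ) + 1 ≠ 0 := by positivity
    have hc : ((l : ℝ) + 1) * ((l + 1 + m).choose m : ℝ) = (l + 1 + m) * ((l + m).choose m : ℝ) := by
      have := Nat.add_one_mul_choose_eq (l + m) l
      have h1 : (l + m).choose l = (l + m).choose m := by
        rw [Nat.choose_symm_add]
      have h2 : (l + m).succ.choose l.succ = (l + 1 + m).choose m := by
        rw [show (l + m).succ = (l + 1) + m by omega, Nat.choose_symm_add]
      rw [h1, h2] at this
      have h3 : ((l + m).succ : ℝ) * ((l + m).choose m : ℝ) =
        ((l + 1 + m).choose m : ℝ) * (l.succ : ℝ) := by exact_mod_cast this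
      push_cast at h3
      linear_combination -h3
    have ho := two_mul_order (m + 1)
    push_cast at ho
    refine mul_left_cancel₀ hl ?_
    push_cast
    rw [ho] at *
    linear_combination ((l : ℝ) + 1 + m) * h + ((l : ℝ) + 1 + m) * ih
      - 2 * order (m + 1) ^ 2 * gegenbauerSqNorm (m + 1) 0 * hc

theorem gegenbauerSqNorm_zero_pos (n : ℕ) : 0 < gegenbauerSqNorm n 0 := by
  have := surf_univ_pos n
  simpa [gegenbauerSqNorm, gegenbauerPoly, zonalIntegral] using this

end Orthogonality

/-! ### The Laplace–Beltrami operator on zonal functions -/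

section ZonalLaplacian

theorem hasDerivAt_line {E : Type*} [NormedAddCommGroup E] [NormedSpace ℝ E] (x v : E) (s : ℝ) :
    HasDerivAt (fun s : ℝ => x + s • v) v s := by
  simpa using ((hasDerivAt_id' s).smul_const v).const_add x

theorem iteratedFDeriv_two_eq_of_hasDerivAt_line {E : Type*} [NormedAddCommGroup E]
    [NormedSpace ℝ E] {g : E → ℝ} {x v : E} (hg : ContDiffAt ℝ 2 g x) {φ' : ℝ → ℝ} {d : ℝ}
    (hφ : ∀ᶠ s in 𝓝 (0 : ℝ), HasDerivAt (fun s : ℝ => g (x + s • v)) (φ' s) s)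
    (hφ' : HasDerivAt φ' d 0) : iteratedFDeriv ℝ 2 g x ![v, v] = d := by
  rw [iteratedFDeriv_two_apply]
  simp only [Matrix.cons_val_zero, Matrix.cons_val_one]
  have hline : Tendsto (fun s : ℝ => x + s • v) (𝓝 0) (𝓝 x) := by
    simpa using (hasDerivAt_line x v 0).continuousAt.tendsto
  have hdiff : ∀ᶠ s in 𝓝 (0 : ℝ), DifferentiableAt ℝ g (x + s • v) :=
    hline.eventually ((hg.eventually (by simp)).mono fun y hy => hy.differentiableAt (by simp))
  have heq : φ' =ᶠ[𝓝 0] fun s => fderiv ℝ g (x + s • v) v := by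
    filter_upwards [hφ, hdiff] with s h₁ h₂
    exact h₁.unique (h₂.hasFDerivAt.comp_hasDerivAt s (hasDerivAt_line x v s))
  have h2 : DifferentiableAt ℝ (fderiv ℝ g) (x + (0 : ℝ) • v) := by
    rw [zero_smul, add_zero]
    exact (hg.fderiv_right (m := 1) (by norm_num)).differentiableAt (by simp)
  have h3 : HasDerivAt (fun s : ℝ => fderiv ℝ g (x + s • v) v)
      (fderiv ℝ (fderiv ℝ g) (x + (0 : ℝ) • v) v v) 0 :=
    (ContinuousLinearMap.apply ℝ ℝ v).hasFDerivAt.comp_hasDerivAt 0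
      (h2.hasFDerivAt.comp_hasDerivAt 0 (hasDerivAt_line x v 0))
  have := (h3.congr_of_eventuallyEq heq).unique hφ'
  simpa using this

/-- For unit vectors x, v with t = x_0, w = v_0 and b = ⟨x, v⟩, the argument of `F` is the first
coordinate of (x + sv)/|x + sv|. -/
theorem hasDerivAt_zonal_line {F : ℝ → ℝ} {t w b : ℝ} (hF : ContDiffAt ℝ 2 F t) :
    ∃ φ' : ℝ → ℝ,
      (∀ᶠ s in 𝓝 (0 : ℝ), HasDerivAt
        (fun s : ℝ => F ((t + s * w) * (1 + 2 * b * s + s ^ 2) ^ (-(1 / 2) : ℝ))) (φ' s) s) ∧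
      HasDerivAt φ' (deriv (deriv F) t * (w - t * b) ^ 2 +
        deriv F t * (-2 * w * b - t + 3 * t * b ^ 2)) 0 := by
  set N : ℝ → ℝ := fun s => 1 + 2 * b * s + s ^ 2 with hN
  have hNd (s : ℝ) : HasDerivAt N (2 * b + 2 * s) s := by
    simpa using
      (((hasDerivAt_id' s).const_mul (2 * b)).const_add 1).fun_add ((hasDerivAt_id' s).fun_pow 2)
  have hN0 : N 0 = 1 := by simp [hN]
  have hNpos : ∀ᶠ s in 𝓝 (0 : ℝ), 0 < N s :=
    (hNd 0).continuousAt.eventually (lt_mem_nhds (by rw [hN0]; exact one_pos))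
  have hpow {s : ℝ} (hs : 0 < N s) (p : ℝ) :
      HasDerivAt (fun s => N s ^ p) ((2 * b + 2 * s) * p * N s ^ (p - 1)) s :=
    (hNd s).rpow_const (Or.inl hs.ne')
  have hlin (s : ℝ) : HasDerivAt (fun s : ℝ => t + s * w) w s := by
    simpa using ((hasDerivAt_id' s).mul_const w).const_add t
  set u : ℝ → ℝ := fun s => (t + s * w) * N s ^ (-(1 / 2) : ℝ) with hu
  set u' : ℝ → ℝ := fun s => w * N s ^ (-(1 / 2) : ℝ) -
    (t + s * w) * (b + s) * N s ^ (-(3 / 2) : ℝ) with hu'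
  have hud {s : ℝ} (hs : 0 < N s) : HasDerivAt u (u' s) s := by
    refine ((hlin s).fun_mul (hpow hs _)).congr_deriv ?_
    rw [hu', show (-(1 / 2) - 1 : ℝ) = -(3 / 2) by norm_num]
    ring
  have h0 : 0 < N 0 := by rw [hN0]; exact one_pos
  have hu0 : u 0 = t := by simp [hu, hN0]
  have hu'0 : u' 0 = w - t * b := by simp [hu', hN0]
  have hu'd : HasDerivAt u' (-2 * w * b - t + 3 * t * b ^ 2) 0 := by
    have hb : HasDerivAt (fun s : ℝ => b + s) 1 0 := (hasDerivAt_id' 0).const_add b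
    refine (((hpow h0 _).const_mul w).fun_sub
      (((hlin 0).fun_mul hb).fun_mul (hpow h0 _))).congr_deriv ?_
    simp only [hN0, Real.one_rpow]
    ring
  have hFd : ∀ᶠ s in 𝓝 (0 : ℝ), DifferentiableAt ℝ F (u s) := by
    have hc : Tendsto u (𝓝 0) (𝓝 t) := by
      simpa [hu0] using (hud h0).continuousAt.tendsto
    exact hc.eventually ((hF.eventually (by simp)).mono fun y hy => hy.differentiableAt (by simp))
  refine ⟨fun s => deriv F (u s) * u' s, ?_, ?_⟩
  · filter_upwards [hNpos, hFd] with s hs hFs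
    exact hFs.hasDerivAt.comp s (hud hs)
  · have hF2 : DifferentiableAt ℝ (deriv F) (u 0) := by
      rw [hu0]
      have := hF.fderiv_right (m := 1) (by norm_num)
      have h' : ContDiffAt ℝ 1 (deriv F) t := this.clm_apply contDiffAt_const
      exact h'.differentiableAt (by simp)
    have := (hF2.hasDerivAt.comp (0 : ℝ) (hud h0)).fun_mul hu'd
    refine this.congr_deriv ?_
    simp only [Function.comp_apply]
    rw [hu0, hu'0]
    ring

theorem sum_coord_sq_sphere {n : ℕ} (x : Sph n) : ∑ i, (x : Ambient n) i ^ 2 = 1 := by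
  have h : ‖(x : Ambient n)‖ = 1 := norm_eq_of_mem_sphere x
  have := EuclideanSpace.norm_sq_eq (x : Ambient n)
  rw [h] at this
  simpa using this.symm

theorem abs_coord_le_one {n : ℕ} (x : Sph n) : |(x : Ambient n) 0| ≤ 1 := by
  have h : ‖(x : Ambient n)‖ = 1 := norm_eq_of_mem_sphere x
  simpa [h] using PiLp.norm_apply_le (x : Ambient n) 0

theorem laplaceBeltrami_zonal {n : ℕ} {F : ℝ → ℝ} (x : Sph n)
    (hF : ContDiffAt ℝ 2 F ((x : Ambient n) 0)) :
    laplaceBeltrami (fun y : Sph n => F ((y : Ambient n) 0)) x =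
      (1 - (x : Ambient n) 0 ^ 2) * deriv (deriv F) ((x : Ambient n) 0) -
        n * (x : Ambient n) 0 * deriv F ((x : Ambient n) 0) := by
  have hx : ‖(x : Ambient n)‖ = 1 := norm_eq_of_mem_sphere x
  have hx0 : (x : Ambient n) ≠ 0 := norm_ne_zero_iff.mp (by rw [hx]; exact one_ne_zero)
  set g : Ambient n → ℝ := fun y => F (‖y‖⁻¹ * y 0) with hg
  have hcongr : radialExt (fun y : Sph n => F ((y : Ambient n) 0)) =ᶠ[𝓝 (x : Ambient n)] g := by
    filter_upwards [isOpen_ne.mem_nhds hx0] with y hy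
    simp only [radialExt, hg]
    rw [dif_pos hy]
    simp
  have hgs : ContDiffAt ℝ 2 g x := by
    have hF' : ContDiffAt ℝ 2 F (‖(x : Ambient n)‖⁻¹ * (x : Ambient n) 0) := by
      simpa [hx] using hF
    have hu : ContDiffAt ℝ 2 (fun y : Ambient n => ‖y‖⁻¹ * y 0) x := by
      refine ((contDiffAt_norm ℝ hx0).inv (by rw [hx]; exact one_ne_zero)).mul ?_
      fun_prop
    exact hF'.comp (x : Ambient n) hu
  have hterm (i : Fin (n + 1)) :
      iteratedFDeriv ℝ 2 g x ![EuclideanSpace.basisFun (Fin (n + 1)) ℝ i,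
        EuclideanSpace.basisFun (Fin (n + 1)) ℝ i] =
      deriv (deriv F) ((x : Ambient n) 0) *
          ((if i = 0 then 1 else 0) - (x : Ambient n) 0 * (x : Ambient n) i) ^ 2 +
        deriv F ((x : Ambient n) 0) * (-2 * (if i = 0 then 1 else 0) * (x : Ambient n) i
          - (x : Ambient n) 0 + 3 * (x : Ambient n) 0 * (x : Ambient n) i ^ 2) := by
    obtain ⟨φ', h₁, h₂⟩ := hasDerivAt_zonal_line (w := if i = 0 then 1 else 0)
      (b := (x : Ambient n) i) hF
    refine iteratedFDeriv_two_eq_of_hasDerivAt_line hgs (φ' := φ') ?_ h₂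
    convert h₁ using 4 with _ s
    have hnorm : ‖(x : Ambient n) + s • EuclideanSpace.basisFun (Fin (n + 1)) ℝ i‖ ^ 2 =
        1 + 2 * (x : Ambient n) i * s + s ^ 2 := by
      rw [norm_add_sq_real, hx, real_inner_smul_right, norm_smul]
      simp [EuclideanSpace.inner_single_right]
      ring
    have hpow : ‖(x : Ambient n) + s • EuclideanSpace.basisFun (Fin (n + 1)) ℝ i‖⁻¹ =
        (1 + 2 * (x : Ambient n) i * s + s ^ 2) ^ (-(1 / 2) : ℝ) := by
      rw [← hnorm, ← Real.rpow_natCast, ← Real.rpow_mul (norm_nonneg _), ← Real.rpow_neg_one]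
      norm_num
    simp only [hg]
    rw [hpow, mul_comm]
    congr 2
    rcases eq_or_ne i 0 with rfl | hi
    · simp
    · simp [hi, hi.symm]
  rw [laplaceBeltrami, (InnerProductSpace.laplacian_congr_nhds hcongr).eq_of_nhds,
    InnerProductSpace.laplacian_eq_iteratedFDeriv_orthonormalBasis g
      (EuclideanSpace.basisFun (Fin (n + 1)) ℝ)]
  simp only [hterm]
  have hsum := sum_coord_sq_sphere x
  rw [Fin.sum_univ_succ] at hsum ⊢
  simp only [if_true, Fin.succ_ne_zero, if_false, zero_sub, neg_sq, mul_pow, mul_zero, zero_mul]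
  rw [Finset.sum_add_distrib, ← Finset.mul_sum, ← Finset.mul_sum, ← Finset.mul_sum,
    Finset.sum_add_distrib, ← Finset.mul_sum]
  -- With t = x_0, the coefficients of F'' sum to (1 - t²)² + t²(1 - t²) = 1 - t², those of F' to
  -- -2t - (n + 1)t + 3t = -nt.
  have hS : ∑ i : Fin n, (x : Ambient n) i.succ ^ 2 = 1 - (x : Ambient n) 0 ^ 2 := by linarith
  rw [hS]
  simp only [Finset.sum_const, Finset.card_univ, Fintype.card_fin, nsmul_eq_mul]
  ring

end ZonalLaplacian

/-! ### Geometrically decaying coefficient sequences -/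

section GeometricDecay

/-- The sequence `α` decays at least geometrically. -/
def GeometricDecay (α : ℕ → ℝ) : Prop :=
  ∃ C θ : ℝ, 0 < θ ∧ θ < 1 ∧ ∀ l, |α l| ≤ C * θ ^ l

theorem GeometricDecay.summable_abs {α : ℕ → ℝ} (h : GeometricDecay α) :
    Summable fun l => |α l| := by
  obtain ⟨C, θ, h0, h1, hle⟩ := h
  exact Summable.of_nonneg_of_le (fun _ => abs_nonneg _) hle
    ((summable_geometric_of_lt_one h0.le h1).mul_left C)

theorem GeometricDecay.summable {α : ℕ → ℝ} (h : GeometricDecay α) : Summable α :=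
  h.summable_abs.of_abs

theorem GeometricDecay.exists_mul_pow {α : ℕ → ℝ} (h : GeometricDecay α) :
    ∃ R : ℝ, 1 < R ∧ GeometricDecay fun l => α l * R ^ l := by
  obtain ⟨C, θ, h0, h1, hle⟩ := h
  have hs0 : 0 < √θ := Real.sqrt_pos.mpr h0
  have hs1 : √θ < 1 := by rw [Real.sqrt_lt' one_pos]; simpa using h1
  refine ⟨(√θ)⁻¹, (one_lt_inv₀ hs0).mpr hs1, C, √θ, hs0, hs1, fun l => ?_⟩
  have hR : 0 < (√θ)⁻¹ ^ l := by positivity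
  rw [abs_mul, abs_of_pos hR]
  refine (mul_le_mul_of_nonneg_right (hle l) hR.le).trans_eq ?_
  rw [mul_assoc, ← mul_pow]
  congr 2
  nth_rewrite 1 [← Real.mul_self_sqrt h0.le]
  field_simp

/-- The decay rate has room for a factor R^l with R > 1, and this factor absorbs the polynomial
growth. -/
theorem GeometricDecay.mul_of_le {α b : ℕ → ℝ} (h : GeometricDecay α) {K : ℝ} {m : ℕ}
    (hb : ∀ l : ℕ, |b l| ≤ K * ((l : ℝ) + 1) ^ m) : GeometricDecay fun l => α l * b l := by
  obtain ⟨R, hR, C, θ, h0, h1, hle⟩ := h.exists_mul_pow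
  have hR0 : 0 < R := one_pos.trans hR
  have hinv : R⁻¹ < 1 := inv_lt_one_of_one_lt₀ hR
  have hsum : Summable fun l : ℕ => ((l : ℝ) + 1) ^ m * R⁻¹ ^ (l + 1) := by
    have := summable_pow_mul_geometric_of_norm_lt_one m (r := R⁻¹)
      (by rwa [Real.norm_of_nonneg (by positivity)])
    have := (summable_nat_add_iff 1).mpr this
    simpa using this
  obtain ⟨B, hB⟩ := hsum.tendsto_atTop_zero.bddAbove_range
  have hB' (l : ℕ) : ((l : ℝ) + 1) ^ m ≤ B * R ^ (l + 1) := by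
    have : ((l : ℝ) + 1) ^ m * R⁻¹ ^ (l + 1) ≤ B := hB ⟨l, rfl⟩
    rwa [inv_pow, ← div_eq_mul_inv, div_le_iff₀ (by positivity)] at this
  refine ⟨C * |K| * B * R, θ, h0, h1, fun l => ?_⟩
  have h2 := hle l
  rw [abs_mul, abs_of_pos (pow_pos hR0 l)] at h2
  rw [abs_mul]
  have hC : 0 ≤ C * θ ^ l := (by positivity : 0 ≤ |α l| * R ^ l).trans h2
  calc |α l| * |b l| ≤ |α l| * (|K| * (B * R ^ (l + 1))) := by
        refine mul_le_mul_of_nonneg_left ((hb l).trans ?_) (abs_nonneg _)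
        exact mul_le_mul (le_abs_self K) (hB' l) (by positivity) (abs_nonneg _)
    _ = (|α l| * R ^ l) * (|K| * (B * R)) := by ring
    _ ≤ (C * θ ^ l) * (|K| * (B * R)) := by
        refine mul_le_mul_of_nonneg_right h2 ?_
        have h3 := hB' 0
        have : 0 ≤ B * R := by
          simp only [CharP.cast_eq_zero, zero_add, one_pow, pow_one] at h3
          linarith
        positivity
    _ = _ := by ring

theorem GeometricDecay.mul {α β : ℕ → ℝ} (hα : GeometricDecay α) (hβ : GeometricDecay β) :
    GeometricDecay fun l => α l * β l := by
  obtain ⟨C, θ, h0, h1, hle⟩ := hβ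
  refine hα.mul_of_le (K := |C|) (m := 0) fun l => (hle l).trans ?_
  rw [pow_zero, mul_one]
  calc C * θ ^ l ≤ |C| * θ ^ l := by gcongr; exact le_abs_self C
    _ ≤ |C| * 1 := by gcongr; exact pow_le_one₀ h0.le h1.le
    _ = _ := mul_one _

theorem GeometricDecay.comp_succ {α : ℕ → ℝ} (h : GeometricDecay α) :
    GeometricDecay fun l => α (l + 1) := by
  obtain ⟨C, θ, h0, h1, hle⟩ := h
  exact ⟨C * θ, θ, h0, h1, fun l => (hle (l + 1)).trans_eq (by ring)⟩

end GeometricDecay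

/-! ### Smoothness and termwise calculus of zonal series -/

section ZonalSeries

open Polynomial

/-- The profile `∑ α_l C_l^lam` of a zonal function. -/
def gegenbauerSeries (lam : ℝ) (α : ℕ → ℝ) (t : ℝ) : ℝ :=
  ∑' l, α l * (gegenbauerPoly lam l).eval t

/-- The holomorphic extension of `gegenbauerSeries`. -/
def complexGegenbauerSeries (lam : ℝ) (α : ℕ → ℝ) (z : ℂ) : ℂ :=
  ∑' l, (α l : ℂ) * aeval z (gegenbauerPoly lam l)

theorem aeval_ofReal_eq (p : ℝ[X]) (t : ℝ) : aeval (t : ℂ) p = ((p.eval t : ℝ) : ℂ) := by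
  have := aeval_algebraMap_apply ℂ t p
  simpa [aeval_def] using this

variable {lam : ℝ} {α : ℕ → ℝ}

theorem exists_summable_bound_bernsteinEllipse (hlam : 0 ≤ lam) (hα : GeometricDecay α) :
    ∃ R : ℝ, 1 < R ∧ ∃ u : ℕ → ℝ, Summable u ∧ ∀ l, ∀ z ∈ bernsteinEllipse R,
      ‖(α l : ℂ) * aeval z (gegenbauerPoly lam l)‖ ≤ u l := by
  obtain ⟨R, hR, hd⟩ := hα.exists_mul_pow
  obtain ⟨m, hm⟩ := exists_nat_ge (2 * lam)
  refine ⟨R, hR, fun l => |α l * R ^ l * (gegenbauerPoly lam l).eval 1|,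
    (hd.mul_of_le (K := 1) (m := m) fun l => ?_).summable_abs, fun l z hz => ?_⟩
  · rw [abs_of_nonneg (eval_one_gegenbauerPoly_nonneg hlam l), one_mul]
    exact eval_one_gegenbauerPoly_le hlam (by linarith) l
  · rw [norm_mul, Complex.norm_real, Real.norm_eq_abs]
    simp only [mul_assoc, abs_mul (α l)]
    refine mul_le_mul_of_nonneg_left ?_ (abs_nonneg _)
    exact (norm_aeval_gegenbauerPoly_le hlam hR hz l).trans (le_abs_self _)

theorem exists_summable_bound_gegenbauer (hlam : 0 ≤ lam) (hα : GeometricDecay α) :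
    ∃ u : ℕ → ℝ, Summable u ∧ ∀ l, ∀ t : ℝ, |t| ≤ 1 →
      |α l * (gegenbauerPoly lam l).eval t| ≤ u l := by
  obtain ⟨R, hR, u, hu, hle⟩ := exists_summable_bound_bernsteinEllipse hlam hα
  refine ⟨u, hu, fun l t ht => ?_⟩
  have := hle l t (ofReal_mem_bernsteinEllipse hR ht)
  rwa [aeval_ofReal_eq, ← Complex.ofReal_mul, Complex.norm_real, Real.norm_eq_abs] at this

theorem hasSum_gegenbauerSeries (hlam : 0 ≤ lam) (hα : GeometricDecay α) {t : ℝ} (ht : |t| ≤ 1) :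
    HasSum (fun l => α l * (gegenbauerPoly lam l).eval t) (gegenbauerSeries lam α t) := by
  obtain ⟨u, hu, hle⟩ := exists_summable_bound_gegenbauer hlam hα
  exact (Summable.of_norm_bounded hu fun l => hle l t ht).hasSum

theorem deriv_sum_aeval (p : ℕ → ℝ[X]) (s : Finset ℕ) :
    deriv (fun z : ℂ => ∑ l ∈ s, (α l : ℂ) * aeval z (p l)) =
      fun z => ∑ l ∈ s, (α l : ℂ) * aeval z (derivative (p l)) := by
  funext z
  refine HasDerivAt.deriv (HasDerivAt.fun_sum fun l _ => ?_)
  exact ((p l).hasDerivAt_aeval z).const_mul _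

theorem gegenbauerSeries_eq_re (t : ℝ) :
    gegenbauerSeries lam α t = (complexGegenbauerSeries lam α t).re := by
  rw [gegenbauerSeries, complexGegenbauerSeries]
  simp only [aeval_ofReal_eq, ← Complex.ofReal_mul]
  rw [← Complex.ofReal_tsum, Complex.ofReal_re]

/-- On `[-1, 1]` the series is smooth and may be differentiated twice term by term. -/
theorem gegenbauerSeries_smooth (hlam : 0 ≤ lam) (hα : GeometricDecay α) {t : ℝ} (ht : |t| ≤ 1) :
    ContDiffAt ℝ 2 (gegenbauerSeries lam α) t ∧
    HasSum (fun l => α l * (derivative (gegenbauerPoly lam l)).eval t)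
      (deriv (gegenbauerSeries lam α) t) ∧
    HasSum (fun l => α l * (derivative (derivative (gegenbauerPoly lam l))).eval t)
      (deriv (deriv (gegenbauerSeries lam α)) t) := by
  -- Uniform convergence holds on a complex neighbourhood of `t`, where locally uniform convergence
  -- of holomorphic functions passes to derivatives; real derivatives are then real parts.
  obtain ⟨R, hR, u, hu, hle⟩ := exists_summable_bound_bernsteinEllipse hlam hα
  set U := bernsteinEllipse R
  have hU : IsOpen U := isOpen_bernsteinEllipse R
  have htU : (t : ℂ) ∈ U := ofReal_mem_bernsteinEllipse hR ht
  set Φ := complexGegenbauerSeries lam α with hΦ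
  have hdiffs (p : ℕ → ℝ[X]) (s : Finset ℕ) :
      DifferentiableOn ℂ (fun z : ℂ => ∑ l ∈ s, (α l : ℂ) * aeval z (p l)) U := fun z _ =>
    (HasDerivAt.fun_sum fun l _ =>
      ((p l).hasDerivAt_aeval z).const_mul (α l : ℂ)).differentiableAt.differentiableWithinAt
  have h0 : TendstoLocallyUniformlyOn
      (fun (s : Finset ℕ) (z : ℂ) => ∑ l ∈ s, (α l : ℂ) * aeval z (gegenbauerPoly lam l))
      Φ atTop U := (tendstoUniformlyOn_tsum hu hle).tendstoLocallyUniformlyOn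
  have h1 := h0.deriv (Eventually.of_forall fun s => hdiffs _ s) hU
  have e1 : (deriv ∘ fun (s : Finset ℕ) (z : ℂ) =>
      ∑ l ∈ s, (α l : ℂ) * aeval z (gegenbauerPoly lam l)) = fun (s : Finset ℕ) (z : ℂ) =>
      ∑ l ∈ s, (α l : ℂ) * aeval z (derivative (gegenbauerPoly lam l)) :=
    funext fun s => deriv_sum_aeval _ s
  rw [e1] at h1
  have h2 := h1.deriv (Eventually.of_forall fun s => hdiffs _ s) hU
  have e2 : (deriv ∘ fun (s : Finset ℕ) (z : ℂ) =>
      ∑ l ∈ s, (α l : ℂ) * aeval z (derivative (gegenbauerPoly lam l))) =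
      fun (s : Finset ℕ) (z : ℂ) =>
      ∑ l ∈ s, (α l : ℂ) * aeval z (derivative (derivative (gegenbauerPoly lam l))) :=
    funext fun s => deriv_sum_aeval _ s
  rw [e2] at h2
  have hΦd : DifferentiableOn ℂ Φ U := h0.differentiableOn
    (Eventually.of_forall fun s => hdiffs _ s) hU
  have hΦd' : DifferentiableOn ℂ (deriv Φ) U := hΦd.deriv hU
  have hre : gegenbauerSeries lam α = fun t : ℝ => (Φ t).re := funext gegenbauerSeries_eq_re
  have hUr : ∀ᶠ s : ℝ in 𝓝 t, (s : ℂ) ∈ U :=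
    Complex.continuous_ofReal.continuousAt.eventually (hU.mem_nhds htU)
  have hd1 {s : ℝ} (hs : (s : ℂ) ∈ U) :
      deriv (gegenbauerSeries lam α) s = (deriv Φ s).re := by
    rw [hre]
    exact (((hΦd _ hs).differentiableAt (hU.mem_nhds hs)).hasDerivAt.real_of_complex).deriv
  have hd2 : deriv (deriv (gegenbauerSeries lam α)) t = (deriv (deriv Φ) t).re := by
    have : deriv (gegenbauerSeries lam α) =ᶠ[𝓝 t] fun s : ℝ => (deriv Φ s).re :=
      hUr.mono fun s hs => hd1 hs
    rw [this.deriv_eq]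
    exact (((hΦd' _ htU).differentiableAt (hU.mem_nhds htU)).hasDerivAt.real_of_complex).deriv
  refine ⟨?_, ?_, ?_⟩
  · rw [hre]
    have : ContDiffAt ℂ 2 Φ t := (hΦd.contDiffOn hU).contDiffAt (hU.mem_nhds htU)
    exact this.real_of_complex
  · rw [hd1 htU]
    have hs : HasSum (fun l => (α l : ℂ) * aeval (t : ℂ) (derivative (gegenbauerPoly lam l))) (deriv Φ t) := by
      rw [HasSum, SummationFilter.unconditional_filter]
      exact h1.tendsto_at htU
    have := Complex.hasSum_re hs
    simpa only [aeval_ofReal_eq, ← Complex.ofReal_mul, Complex.ofReal_re] using this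
  · rw [hd2]
    have hs : HasSum (fun l => (α l : ℂ) * aeval (t : ℂ) (derivative (derivative (gegenbauerPoly lam l)))) (deriv (deriv Φ) t) := by
      rw [HasSum, SummationFilter.unconditional_filter]
      exact h2.tendsto_at htU
    have := Complex.hasSum_re hs
    simpa only [aeval_ofReal_eq, ← Complex.ofReal_mul, Complex.ofReal_re] using this

/-- The zonal function on the sphere with Gegenbauer coefficients `α`. -/
def zonalSeries (n : ℕ) (α : ℕ → ℝ) (x : Sph n) : ℝ :=
  gegenbauerSeries (order n) α ((x : Ambient n) 0)

theorem contMDiff_zonalSeries {n : ℕ} (hn : 2 ≤ n) (hα : GeometricDecay α) :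
    ContMDiff (𝓡 n) 𝓘(ℝ, ℝ) 2 (zonalSeries n α) := by
  have : Fact (Module.finrank ℝ (Ambient n) = n + 1) := ⟨by simp⟩
  intro x
  have h1 : ContMDiff (𝓡 n) 𝓘(ℝ, ℝ) 2 (fun x : Sph n => (x : Ambient n) 0) := by
    have hp : ContDiff ℝ 2 (fun y : Ambient n => y 0) := by fun_prop
    exact hp.contMDiff.comp (contMDiff_coe_sphere.of_le le_top)
  exact ContMDiffAt.comp x
    ((gegenbauerSeries_smooth (order_pos hn).le hα (abs_coord_le_one x)).1.contMDiffAt) (h1 x)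

theorem continuous_zonalSeries {n : ℕ} (hn : 2 ≤ n) (hα : GeometricDecay α) :
    Continuous (zonalSeries n α) := (contMDiff_zonalSeries hn hα).continuous

theorem laplaceBeltrami_zonalSeries {n : ℕ} (hn : 2 ≤ n) (hα : GeometricDecay α) (x : Sph n) :
    laplaceBeltrami (zonalSeries n α) x =
      zonalSeries n (fun l => α l * -((l : ℝ) * (l + 2 * order n))) x := by
  have hx := abs_coord_le_one x
  obtain ⟨hs, h1, h2⟩ := gegenbauerSeries_smooth (order_pos hn).le hα hx
  have h := (h2.mul_left (1 - (x : Ambient n) 0 ^ 2)).sub (h1.mul_left (n * (x : Ambient n) 0))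
  rw [show zonalSeries n α = fun y : Sph n => gegenbauerSeries (order n) α ((y : Ambient n) 0)
    from rfl, laplaceBeltrami_zonal x hs, ← h.tsum_eq, zonalSeries, gegenbauerSeries]
  refine tsum_congr fun l => ?_
  have ho := congrArg (eval ((x : Ambient n) 0)) (gegenbauerPoly_ode (order n) l)
  rw [two_mul_order, sub_add_cancel] at ho
  simp only [eval_sub, eval_mul, eval_one, eval_pow, eval_X, eval_C, eval_neg] at ho
  rw [two_mul_order]
  linear_combination α l * ho

theorem hasSum_integral_zonalSeries_mul {n : ℕ} (hn : 2 ≤ n) (hα : GeometricDecay α)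
    {g : Sph n → ℝ} (hg : Continuous g) :
    HasSum (fun l => α l * ∫ x : Sph n,
        (gegenbauerPoly (order n) l).eval ((x : Ambient n) 0) * g x ∂(surf n))
      (∫ x, zonalSeries n α x * g x ∂(surf n)) := by
  obtain ⟨u, hu, hle⟩ := exists_summable_bound_gegenbauer (order_pos hn).le hα
  have hint (l : ℕ) : Integrable (fun x : Sph n =>
      α l * (gegenbauerPoly (order n) l).eval ((x : Ambient n) 0) * g x) (surf n) :=
    integrable_of_continuous_sphere
      ((continuous_const.mul (continuous_eval_coord n _)).mul hg)
  have h := hasSum_integral_of_summable_integral_norm hint (Summable.of_nonneg_of_le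
    (fun l => integral_nonneg fun x => norm_nonneg _) (fun l => ?_)
    (hu.mul_right (∫ x, ‖g x‖ ∂(surf n))))
  · simp only [mul_assoc, integral_const_mul] at h
    have e : (fun x => zonalSeries n α x * g x) = fun x : Sph n =>
        ∑' l, α l * ((gegenbauerPoly (order n) l).eval ((x : Ambient n) 0) * g x) := by
      funext x
      rw [zonalSeries, gegenbauerSeries, ← tsum_mul_right]
      simp only [mul_assoc]
    rwa [e]
  · rw [← integral_const_mul]
    refine integral_mono (hint l).norm ((integrable_of_continuous_sphere hg.norm).const_mul _)
      fun x => ?_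
    simp only [norm_mul _ (g x)]
    exact mul_le_mul_of_nonneg_right (hle l _ (abs_coord_le_one x)) (norm_nonneg _)

theorem integral_gegenbauerPoly_mul_zonalSeries {n : ℕ} (hn : 2 ≤ n) (hα : GeometricDecay α)
    (m : ℕ) : ∫ x : Sph n, (gegenbauerPoly (order n) m).eval ((x : Ambient n) 0) *
      zonalSeries n α x ∂(surf n) = α m * gegenbauerSqNorm n m := by
  have h := hasSum_integral_zonalSeries_mul hn hα
    (continuous_eval_coord n (gegenbauerPoly (order n) m))
  have hz (l : ℕ) : ∫ x : Sph n, (gegenbauerPoly (order n) l).eval ((x : Ambient n) 0) *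
      (gegenbauerPoly (order n) m).eval ((x : Ambient n) 0) ∂(surf n) =
      zonalIntegral n (gegenbauerPoly (order n) l * gegenbauerPoly (order n) m) := by
    simp [zonalIntegral]
  simp only [hz] at h
  have h' := hasSum_single (f := fun l => α l * zonalIntegral n
    (gegenbauerPoly (order n) l * gegenbauerPoly (order n) m)) m fun l hl => by
      rw [zonalIntegral_gegenbauerPoly_mul_of_ne hn hl, mul_zero]
  rw [gegenbauerSqNorm, ← h.unique h']
  simp only [mul_comm]

theorem hasSum_integral_zonalSeries_mul_zonalSeries {n : ℕ} (hn : 2 ≤ n) {β : ℕ → ℝ}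
    (hα : GeometricDecay α) (hβ : GeometricDecay β) :
    HasSum (fun l => α l * (β l * gegenbauerSqNorm n l))
      (∫ x, zonalSeries n α x * zonalSeries n β x ∂(surf n)) := by
  have := hasSum_integral_zonalSeries_mul hn hα (continuous_zonalSeries hn hβ)
  simpa only [integral_gegenbauerPoly_mul_zonalSeries hn hβ] using this

end ZonalSeries

/-! ### Exact series for mass and first moment, and a bound for the energy -/

section Quadratic

open Polynomial

/-- The weights `binom(l + n - 1, n - 1)`, up to a factor depending on `n` only. -/
def zonalWeight (n l : ℕ) : ℝ := 2 * gegenbauerSqNorm n 0 * ((l + n - 1).choose (n - 1) : ℝ)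

theorem zonalWeight_nonneg (n l : ℕ) : 0 ≤ zonalWeight n l := by
  have := gegenbauerSqNorm_zero_pos n
  rw [zonalWeight]; positivity

theorem zonalWeight_le {n : ℕ} (hn : 2 ≤ n) (l : ℕ) :
    zonalWeight n l ≤ 2 * gegenbauerSqNorm n 0 * n ^ (n - 1) * ((l : ℝ) + 1) ^ (n - 1) := by
  have h0 := gegenbauerSqNorm_zero_pos n
  rw [zonalWeight, mul_assoc (2 * gegenbauerSqNorm n 0), ← mul_pow]
  refine mul_le_mul_of_nonneg_left ?_ (by positivity)
  have h1 : (l + n - 1).choose (n - 1) ≤ (l + n - 1) ^ (n - 1) := Nat.choose_le_pow _ _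
  have h2 : l + n - 1 ≤ n * (l + 1) := by
    have : l ≤ n * l := Nat.le_mul_of_pos_left l (by omega)
    rw [mul_add, mul_one]; omega
  have h3 : (l + n - 1).choose (n - 1) ≤ (n * (l + 1)) ^ (n - 1) :=
    h1.trans (Nat.pow_le_pow_left h2 _)
  exact_mod_cast h3

theorem le_zonalWeight {n : ℕ} (hn : 2 ≤ n) (l : ℕ) :
    2 * gegenbauerSqNorm n 0 / ((n - 1).factorial : ℝ) * (l : ℝ) ^ (n - 1) ≤ zonalWeight n l := by
  have h0 := gegenbauerSqNorm_zero_pos n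
  have h1 := Nat.pow_le_choose (n - 1) (l + n - 1) (α := ℝ)
  have h2 : l + n - 1 + 1 - (n - 1) = l + 1 := by omega
  rw [h2] at h1
  rw [zonalWeight, div_mul_eq_mul_div, mul_div_assoc]
  refine mul_le_mul_of_nonneg_left (le_trans ?_ h1) (by positivity)
  gcongr
  exact_mod_cast Nat.le_succ l

theorem zonalWeight_eq {n : ℕ} (hn : 2 ≤ n) (l : ℕ) :
    order n ^ 2 * zonalWeight n l = (l + order n) * (l + 2 * order n) * gegenbauerSqNorm n l := by
  rw [gegenbauerSqNorm_eq hn, zonalWeight]; ring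

/-- Added to `zonalWeight_eq` at `l + 1`, this gives λ²(W_l + W_{l+1}) = 2(l + 1 + λ)² h_{l+1}: each
mass term splits between two neighbouring weights. -/
theorem zonalWeight_eq_succ {n : ℕ} (hn : 2 ≤ n) (l : ℕ) :
    order n ^ 2 * zonalWeight n l =
      (l + 1) * (l + 1 + order n) * gegenbauerSqNorm n (l + 1) := by
  rw [zonalWeight_eq hn, gegenbauerSqNorm_succ hn]

theorem gegenbauerSqNorm_nonneg (n l : ℕ) : 0 ≤ gegenbauerSqNorm n l := by
  simp only [gegenbauerSqNorm, zonalIntegral, LinearMap.coe_mk, AddHom.coe_mk, eval_mul]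
  exact integral_nonneg fun x => mul_self_nonneg _

variable {w : ℕ → ℝ}

/-- The coefficients `w_l (l + λ) / λ`. -/
def scaledCoeff (n : ℕ) (w : ℕ → ℝ) (l : ℕ) : ℝ := w l * (((l : ℝ) + order n) / order n)

theorem GeometricDecay.scaledCoeff {n : ℕ} (hn : 2 ≤ n) (hw : GeometricDecay w) :
    GeometricDecay (scaledCoeff n w) := by
  have ho := order_pos hn
  refine hw.mul_of_le (K := 1 / order n + 1) (m := 1) fun l => ?_
  rw [abs_of_nonneg (by positivity), pow_one]
  have : (0 : ℝ) ≤ l := by positivity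
  field_simp
  nlinarith

theorem GeometricDecay.mul_zonalWeight {n : ℕ} (hn : 2 ≤ n) (hw : GeometricDecay w) :
    GeometricDecay fun l => w l * zonalWeight n l :=
  hw.mul_of_le fun l => by
    rw [abs_of_nonneg (zonalWeight_nonneg n l)]
    exact zonalWeight_le hn l

/-- Summation by parts: averaging a summable sequence with its backward shift. -/
theorem hasSum_average_shift {s b : ℕ → ℝ} {S : ℝ} (hs : Summable s) (hb : HasSum b S)
    (h0 : 2 * b 0 = s 0) {r : ℕ → ℝ} (hr : Summable r) (h1 : ∀ l, 2 * b (l + 1) = s (l + 1) + r l) :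
    HasSum (fun l => (s l + r l) / 2) S := by
  have hb' := hb.summable
  have e1 := hb'.tsum_eq_zero_add
  have e2 := hs.tsum_eq_zero_add
  have e3 : ∑' l, b (l + 1) = (∑' l, s (l + 1) + ∑' l, r l) / 2 := by
    rw [← ((summable_nat_add_iff 1).mpr hs).tsum_add hr, ← tsum_div_const]
    exact tsum_congr fun l => by rw [← h1]; ring
  have h2 := (hs.hasSum.add hr.hasSum).div_const 2
  have : (∑' l, s l + ∑' l, r l) / 2 = S := by
    rw [← hb.tsum_eq, e1, e2, e3]
    linarith
  rwa [this] at h2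

theorem order_mul_scaledCoeff {n : ℕ} (hn : 2 ≤ n) (w : ℕ → ℝ) (l : ℕ) :
    order n * scaledCoeff n w l = w l * (l + order n) := by
  have := order_pos hn
  rw [scaledCoeff]; field_simp

theorem zonalWeight_zero (n : ℕ) : zonalWeight n 0 = 2 * gegenbauerSqNorm n 0 := by
  simp [zonalWeight]

theorem hasSum_integral_sq_zonalSeries {n : ℕ} (hn : 2 ≤ n) (hw : GeometricDecay w) :
    HasSum (fun l => zonalWeight n l * (w l ^ 2 + w (l + 1) ^ 2) / 2)
      (∫ x, |zonalSeries n (scaledCoeff n w) x| ^ 2 ∂(surf n)) := by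
  have ho := order_pos hn
  have ho2 : order n ^ 2 ≠ 0 := by positivity
  have hα := hw.scaledCoeff hn
  have h := hasSum_integral_zonalSeries_mul_zonalSeries hn hα hα
  have e : (fun x => |zonalSeries n (scaledCoeff n w) x| ^ 2) =
      fun x => zonalSeries n (scaledCoeff n w) x * zonalSeries n (scaledCoeff n w) x := by
    funext x; rw [sq_abs, sq]
  have hd := (hw.mul hw).mul_zonalWeight hn
  have hd' := (hw.comp_succ.mul hw.comp_succ).mul_zonalWeight hn
  rw [e]
  have := hasSum_average_shift hd.summable h ?_ hd'.summable fun l => ?_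
  · convert this using 2 with l
    ring
  -- The term l = 0 has no left neighbour; the split survives because W_0 = 2h_0.
  · refine mul_left_cancel₀ ho2 ?_
    have hα := order_mul_scaledCoeff hn w 0
    rw [zonalWeight_zero]
    simp only [CharP.cast_eq_zero, zero_add] at hα
    linear_combination 2 * gegenbauerSqNorm n 0 *
      (order n * scaledCoeff n w 0 + w 0 * order n) * hα
  · refine mul_left_cancel₀ ho2 ?_
    have hα := order_mul_scaledCoeff hn w (l + 1)
    have e1 := zonalWeight_eq hn (l + 1)
    have e2 := zonalWeight_eq_succ hn l
    push_cast at hα e1 e2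
    linear_combination 2 * gegenbauerSqNorm n (l + 1) *
      (order n * scaledCoeff n w (l + 1) + w (l + 1) * (l + 1 + order n)) * hα
      - w (l + 1) ^ 2 * (e1 + e2)

/-- By the recurrence, x_1 C_l pairs with C_{l+1} and C_{l-1}. The l-th term is therefore the
average of W_l w_l w_{l+1} and W_{l-1} w_{l-1} w_l, and summation by parts merges the two copies. -/
theorem hasSum_integral_coord_mul_sq_zonalSeries {n : ℕ} (hn : 2 ≤ n) (hw : GeometricDecay w) :
    HasSum (fun l => zonalWeight n l * (w l * w (l + 1)))
      (∫ x : Sph n, |zonalSeries n (scaledCoeff n w) x| ^ 2 * (x : Ambient n) 0 ∂(surf n)) := by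
  have ho := order_pos hn
  have ho2 : order n ^ 2 ≠ 0 := by positivity
  have hα := hw.scaledCoeff hn
  set f := zonalSeries n (scaledCoeff n w) with hf
  have hfc : Continuous f := continuous_zonalSeries hn hα
  have hxc : Continuous fun x : Sph n => (x : Ambient n) 0 := by fun_prop
  have h := hasSum_integral_zonalSeries_mul hn hα (g := fun x => (x : Ambient n) 0 * f x)
    (hxc.mul hfc)
  have hint (l : ℕ) : Integrable (fun x : Sph n =>
      (gegenbauerPoly (order n) l).eval ((x : Ambient n) 0) * f x) (surf n) :=
    integrable_of_continuous_sphere ((continuous_eval_coord n _).mul hfc)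
  have hI := integral_gegenbauerPoly_mul_zonalSeries hn hα
  set J : ℕ → ℝ := fun l => ∫ x : Sph n,
    (gegenbauerPoly (order n) l).eval ((x : Ambient n) 0) * ((x : Ambient n) 0 * f x) ∂(surf n)
    with hJ
  have hJ0 : 2 * order n * J 0 = scaledCoeff n w 1 * gegenbauerSqNorm n 1 := by
    rw [← hI 1, hJ, ← integral_const_mul]
    refine integral_congr_ae (ae_of_all _ fun x => ?_)
    simp only [gegenbauerPoly, eval_one, eval_mul, eval_C, eval_X, hf]
    ring
  have hJs (l : ℕ) : 2 * ((l : ℝ) + 1 + order n) * J (l + 1) =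
      (l + 2) * (scaledCoeff n w (l + 2) * gegenbauerSqNorm n (l + 2)) +
      (l + 2 * order n) * (scaledCoeff n w l * gegenbauerSqNorm n l) := by
    rw [← hI (l + 2), ← hI l, hJ, ← integral_const_mul, ← integral_const_mul, ← integral_const_mul,
      ← integral_add ((hint (l + 2)).const_mul _) ((hint l).const_mul _)]
    refine integral_congr_ae (ae_of_all _ fun x => ?_)
    have hr := congrArg (eval ((x : Ambient n) 0)) (gegenbauerPoly_recurrence (order n) l)
    simp only [eval_mul, eval_C, eval_X, eval_sub] at hr
    simp only [hf]
    linear_combination -zonalSeries n (scaledCoeff n w) x * hr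
  have e : (fun x : Sph n => |f x| ^ 2 * (x : Ambient n) 0) =
      fun x => f x * ((x : Ambient n) 0 * f x) := by
    funext x; rw [sq_abs]; ring
  have hd := (hw.mul hw.comp_succ).mul_zonalWeight hn
  rw [e]
  have := hasSum_average_shift hd.summable h ?_ hd.summable fun l => ?_
  · convert this using 2 with l
    ring
  · refine mul_left_cancel₀ ho2 ?_
    have hα0 := order_mul_scaledCoeff hn w 0
    have hα1 := order_mul_scaledCoeff hn w 1
    have e2 := zonalWeight_eq_succ hn 0
    simp only [CharP.cast_eq_zero, zero_add, Nat.cast_one] at hα0 hα1 e2 ⊢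
    linear_combination 2 * order n * J 0 * hα0 + w 0 * order n * hJ0
      + w 0 * gegenbauerSqNorm n 1 * hα1 - w 0 * w 1 * e2
  · refine mul_left_cancel₀ ho2 ?_
    have hα0 := order_mul_scaledCoeff hn w l
    have hα1 := order_mul_scaledCoeff hn w (l + 1)
    have hα2 := order_mul_scaledCoeff hn w (l + 2)
    have e1 := zonalWeight_eq hn l
    have e2 := zonalWeight_eq_succ hn (l + 1)
    push_cast at hα0 hα1 hα2 e1 e2
    linear_combination 2 * order n * J (l + 1) * hα1 + w (l + 1) * order n * hJs l
      + w (l + 1) * (l + 2) * gegenbauerSqNorm n (l + 2) * hα2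
      + w (l + 1) * (l + 2 * order n) * gegenbauerSqNorm n l * hα0
      - w (l + 1) * w (l + 2) * e2 - w l * w (l + 1) * e1

theorem integral_laplaceBeltrami_mul_zonalSeries_bounds {n : ℕ} (hn : 2 ≤ n)
    (hw : GeometricDecay w) :
    0 ≤ -∫ x, laplaceBeltrami (zonalSeries n (scaledCoeff n w)) x *
        zonalSeries n (scaledCoeff n w) x ∂(surf n) ∧
    -∫ x, laplaceBeltrami (zonalSeries n (scaledCoeff n w)) x *
        zonalSeries n (scaledCoeff n w) x ∂(surf n) ≤
      ∑' l : ℕ, (l : ℝ) * (l + 2 * order n) * (zonalWeight n l * w l ^ 2) := by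
  have ho := order_pos hn
  have hα := hw.scaledCoeff hn
  have hfac (l : ℕ) : |(l : ℝ) * (l + 2 * order n)| ≤ (1 + 2 * order n) * ((l : ℝ) + 1) ^ 2 := by
    rw [abs_of_nonneg (by positivity)]
    have : (0 : ℝ) ≤ l := by positivity
    nlinarith [mul_nonneg ho.le this, mul_nonneg ho.le (mul_nonneg this this)]
  have hβ : GeometricDecay fun l => scaledCoeff n w l * -((l : ℝ) * (l + 2 * order n)) :=
    hα.mul_of_le fun l => by rw [abs_neg]; exact hfac l
  have h := (hasSum_integral_zonalSeries_mul_zonalSeries hn hβ hα).neg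
  simp only [laplaceBeltrami_zonalSeries hn hα]
  have hs := ((hw.mul hw).mul_zonalWeight hn).mul_of_le hfac
  refine ⟨h.nonneg fun l => ?_, ?_⟩
  · have := gegenbauerSqNorm_nonneg n l
    rw [show -(scaledCoeff n w l * -((l : ℝ) * (l + 2 * order n)) *
      (scaledCoeff n w l * gegenbauerSqNorm n l)) = scaledCoeff n w l ^ 2 *
        (l * (l + 2 * order n) * gegenbauerSqNorm n l) by ring]
    positivity
  · have hs' : Summable fun l : ℕ => (l : ℝ) * (l + 2 * order n) * (zonalWeight n l * w l ^ 2) :=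
      hs.summable.congr fun l => by ring
    refine hasSum_le (fun l => ?_) h hs'.hasSum
    have h0 := gegenbauerSqNorm_nonneg n l
    -- Only an upper bound is needed, so one factor l + λ is enlarged to l + 2λ to produce the
    -- weight.
    have hle : scaledCoeff n w l ^ 2 * gegenbauerSqNorm n l ≤ zonalWeight n l * w l ^ 2 := by
      refine le_of_mul_le_mul_left ?_ (by positivity : 0 < order n ^ 2)
      have hα := order_mul_scaledCoeff hn w l
      have e1 := zonalWeight_eq hn l
      have : order n ^ 2 * (scaledCoeff n w l ^ 2 * gegenbauerSqNorm n l) =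
          w l ^ 2 * ((l + order n) * (l + order n) * gegenbauerSqNorm n l) := by
        linear_combination gegenbauerSqNorm n l *
          (order n * scaledCoeff n w l + w l * (l + order n)) * hα
      rw [this, mul_comm (zonalWeight n l), mul_left_comm (order n ^ 2), e1]
      gcongr
      linarith
    calc _ = (l : ℝ) * (l + 2 * order n) * (scaledCoeff n w l ^ 2 * gegenbauerSqNorm n l) := by ring
      _ ≤ _ := by gcongr

end Quadratic

/-! ### Bounds for the polynomial and for the profile -/

section Estimates

/-- Increments of a bounded `T` take the place of a comparison integral. Index 0 is kept apart
because the assumptions on the polynomial start at l = 1. -/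
theorem tsum_le_of_telescoping {f T : ℕ → ℝ} {c₀ c₁ : ℝ} (hf : ∀ l, 0 ≤ f l) (h0 : f 0 ≤ c₀)
    (hT0 : 0 ≤ T 1) (hT : ∀ l, 1 ≤ l → T l ≤ c₁) (h : ∀ l, 1 ≤ l → f l ≤ T (l + 1) - T l) :
    ∑' l, f l ≤ c₀ + c₁ := by
  have hpart (N : ℕ) : ∑ l ∈ Finset.range (N + 1), f l ≤ c₀ + (T (N + 1) - T 1) := by
    induction N with
    | zero => simpa using h0
    | succ N ih =>
      rw [Finset.sum_range_succ]
      linarith [h (N + 1) (by omega)]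
  refine Real.tsum_le_of_sum_range_le hf fun N => ?_
  calc ∑ l ∈ Finset.range N, f l ≤ ∑ l ∈ Finset.range (N + 1), f l := by
        rw [Finset.sum_range_succ]; linarith [hf N]
    _ ≤ _ := (hpart N).trans (by linarith [hT (N + 1) (by omega)])

/-- On the positive integers a positive polynomial is comparable to its leading power. -/
theorem exists_eval_bounds {q : Polynomial ℝ} {ν : ℕ} (hν : 1 ≤ ν) (hdeg : q.natDegree = ν)
    (hpos : ∀ l : ℕ, 1 ≤ l → 0 < q.eval (l : ℝ)) :
    ∃ k₁ k₂ : ℝ, 0 < k₁ ∧ 0 < k₂ ∧ ∀ l : ℕ, 1 ≤ l →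
      k₁ * (l : ℝ) ^ ν ≤ q.eval (l : ℝ) ∧ q.eval (l : ℝ) ≤ k₂ * (l : ℝ) ^ ν := by
  have hq0 : q ≠ 0 := by
    rintro rfl
    rw [Polynomial.natDegree_zero] at hdeg
    omega
  have hlead : q.leadingCoeff ≠ 0 := Polynomial.leadingCoeff_ne_zero.mpr hq0
  -- The ratio has a nonzero limit, so both it and its inverse are bounded sequences.
  have hlim : Tendsto (fun l : ℕ => q.eval ((l + 1 : ℕ) : ℝ) / ((l + 1 : ℕ) : ℝ) ^ ν) atTop
      (𝓝 q.leadingCoeff) := by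
    have h := Polynomial.div_tendsto_atTop_leadingCoeff_div_of_degree_eq q (Polynomial.X ^ ν) (by
      rw [Polynomial.degree_X_pow, Polynomial.degree_eq_natDegree hq0, hdeg])
    simp only [Polynomial.eval_pow, Polynomial.eval_X, Polynomial.leadingCoeff_X_pow, div_one] at h
    exact h.comp (tendsto_natCast_atTop_atTop.comp (tendsto_add_atTop_nat 1))
  have hlim' := hlim.inv₀ hlead
  obtain ⟨K, hK⟩ := hlim.bddAbove_range
  obtain ⟨K', hK'⟩ := hlim'.bddAbove_range
  have hr (l : ℕ) : 0 < q.eval ((l + 1 : ℕ) : ℝ) / ((l + 1 : ℕ) : ℝ) ^ ν :=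
    div_pos (hpos _ (by omega)) (by positivity)
  have hKpos : 0 < K := (hr 0).trans_le (hK ⟨0, rfl⟩)
  have hKpos' : 0 < K' := (inv_pos.mpr (hr 0)).trans_le (hK' ⟨0, rfl⟩)
  refine ⟨K'⁻¹, K, inv_pos.mpr hKpos', hKpos, fun l hl => ?_⟩
  obtain ⟨m, rfl⟩ : ∃ m, l = m + 1 := ⟨l - 1, by omega⟩
  have hp : (0 : ℝ) < ((m + 1 : ℕ) : ℝ) ^ ν := by positivity
  constructor
  · rw [← le_div_iff₀ hp]
    exact inv_le_of_inv_le₀ (hr m) (hK' ⟨m, rfl⟩)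
  · rw [← div_le_iff₀ hp]
    exact hK ⟨m, rfl⟩

/-- The generating profile `y ^ c e^{-y}`. -/
def profile (c y : ℝ) : ℝ := y ^ c * Real.exp (-y)

theorem profile_nonneg {c y : ℝ} (hy : 0 ≤ y) : 0 ≤ profile c y := by
  unfold profile; positivity

theorem exists_one_add_pow_mul_exp_le (m : ℕ) {b : ℝ} (hb : 0 < b) :
    ∃ B : ℝ, 0 < B ∧ ∀ y : ℝ, 0 ≤ y → (1 + y) ^ m * Real.exp (-(b * y)) ≤ B := by
  refine ⟨m.factorial / b ^ m * Real.exp b, by positivity, fun y hy => ?_⟩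
  have h := Real.pow_div_factorial_le_exp (b * (1 + y)) (by positivity) m
  rw [div_le_iff₀ (by positivity), mul_pow] at h
  have h2 : Real.exp (b * (1 + y)) = Real.exp b * Real.exp (b * y) := by
    rw [← Real.exp_add]; congr 1; ring
  rw [Real.exp_neg, ← div_eq_mul_inv, div_le_iff₀ (Real.exp_pos _)]
  rw [h2] at h
  rw [div_mul_eq_mul_div, div_mul_eq_mul_div, le_div_iff₀ (by positivity)]
  linarith

theorem rpow_le_one_add_pow {c y : ℝ} (hc : 0 < c) (hy : 0 ≤ y) : y ^ c ≤ (1 + y) ^ ⌈c⌉₊ := by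
  calc y ^ c ≤ (1 + y) ^ c := Real.rpow_le_rpow hy (by linarith) hc.le
    _ ≤ (1 + y) ^ ((⌈c⌉₊ : ℕ) : ℝ) :=
      Real.rpow_le_rpow_of_exponent_le (by linarith) (Nat.le_ceil c)
    _ = _ := Real.rpow_natCast _ _

/-- Half of the exponential absorbs all powers; the other half is kept as decay. -/
theorem exists_one_add_pow_mul_profile_le {c : ℝ} (hc : 0 < c) (m : ℕ) :
    ∃ B : ℝ, 0 < B ∧ ∀ y : ℝ, 0 ≤ y →
      (1 + y) ^ m * profile c y ≤ B * Real.exp (-(1 / 2 * y)) := by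
  obtain ⟨B, hB, h⟩ := exists_one_add_pow_mul_exp_le (m + ⌈c⌉₊) (one_half_pos (α := ℝ))
  refine ⟨B, hB, fun y hy => ?_⟩
  have he : Real.exp (-y) = Real.exp (-(1 / 2 * y)) * Real.exp (-(1 / 2 * y)) := by
    rw [← Real.exp_add]; congr 1; ring
  rw [profile, he]
  calc (1 + y) ^ m * (y ^ c * (Real.exp (-(1 / 2 * y)) * Real.exp (-(1 / 2 * y))))
      ≤ (1 + y) ^ m * ((1 + y) ^ ⌈c⌉₊ * (Real.exp (-(1 / 2 * y)) * Real.exp (-(1 / 2 * y)))) := by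
        gcongr
        exact rpow_le_one_add_pow hc hy
    _ = ((1 + y) ^ (m + ⌈c⌉₊) * Real.exp (-(1 / 2 * y))) * Real.exp (-(1 / 2 * y)) := by
        rw [pow_add]; ring
    _ ≤ _ := by gcongr; exact h y hy

theorem hasDerivAt_profile {c y : ℝ} (hy : 0 < y) :
    HasDerivAt (profile c) (y ^ (c - 1) * Real.exp (-y) * (c - y)) y := by
  have h := (Real.hasDerivAt_rpow_const (p := c) (Or.inl hy.ne')).fun_mul
    ((hasDerivAt_id' y).fun_neg.exp)
  refine h.congr_deriv ?_
  rw [Real.rpow_sub_one hy.ne']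
  field_simp
  ring

/-- This bounded increasing function is the majorant for the variation of the profile: its
derivative has the same factor y^{c-1}, unbounded at 0 when c < 1, and only polynomial decay. -/
theorem hasDerivAt_div_one_add_rpow {c y : ℝ} (hy : 0 < y) :
    HasDerivAt (fun y : ℝ => (y / (1 + y)) ^ c)
      (c * y ^ (c - 1) * (1 + y) ^ (-(c + 1))) y := by
  have h1 : (0 : ℝ) < 1 + y := by linarith
  have h := ((hasDerivAt_id' y).fun_div ((hasDerivAt_id' y).const_add 1) h1.ne').rpow_const
    (p := c) (Or.inl (div_pos hy h1).ne')
  refine h.congr_deriv ?_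
  rw [Real.div_rpow hy.le h1.le, Real.rpow_neg h1.le, Real.rpow_add_one h1.ne',
    Real.rpow_sub_one h1.ne']
  have := Real.rpow_pos_of_pos h1 c
  field_simp
  ring

/-- The weighted variation of the profile is dominated by the increments of a bounded function. -/
theorem exists_weighted_variation_profile {c : ℝ} (hc : 0 < c) (m : ℕ) :
    ∃ K : ℝ, 0 < K ∧ ∀ y z : ℝ, 0 < y → y ≤ z →
      (1 + y) ^ m * |profile c z - profile c y| ≤
        K * (z / (1 + z)) ^ c - K * (y / (1 + y)) ^ c := by
  -- The exponent collects m from the weight, ⌈c + 1⌉ from the majorant's decay (1 + s)^{-(c+1)},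
  -- and 1 from |c - s| ≤ (c + 1)(1 + s).
  obtain ⟨B, hB, hBle⟩ := exists_one_add_pow_mul_exp_le (m + ⌈c + 1⌉₊ + 1) one_pos
  refine ⟨B * (c + 1) / c, by positivity, fun y z hy hyz => ?_⟩
  set K := B * (c + 1) / c with hK
  have hkey {s : ℝ} (hs : y ≤ s) : (1 + y) ^ m * |s ^ (c - 1) * Real.exp (-s) * (c - s)| ≤
      K * (c * s ^ (c - 1) * (1 + s) ^ (-(c + 1))) := by
    have hs0 : 0 < s := hy.trans_le hs
    have h1s : (0 : ℝ) < 1 + s := by linarith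
    have hsc : 0 < s ^ (c - 1) := Real.rpow_pos_of_pos hs0 _
    have hP : 0 < (1 + s) ^ (c + 1) := Real.rpow_pos_of_pos h1s _
    have hb := hBle s hs0.le
    rw [one_mul] at hb
    have habs : |c - s| ≤ (c + 1) * (1 + s) := by
      rw [abs_le]; constructor <;> nlinarith
    have hpow : (1 + s) ^ (c + 1) ≤ (1 + s) ^ ⌈c + 1⌉₊ := by
      rw [← Real.rpow_natCast]
      exact Real.rpow_le_rpow_of_exponent_le (by linarith) (Nat.le_ceil _)
    have hmain : (1 + s) ^ m * (Real.exp (-s) * ((c + 1) * (1 + s))) * (1 + s) ^ (c + 1) ≤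
        B * (c + 1) := by
      calc _ ≤ (1 + s) ^ m * (Real.exp (-s) * ((c + 1) * (1 + s))) * (1 + s) ^ ⌈c + 1⌉₊ := by gcongr
        _ = ((1 + s) ^ (m + ⌈c + 1⌉₊ + 1) * Real.exp (-s)) * (c + 1) := by
          rw [pow_add, pow_add]; ring
        _ ≤ _ := by gcongr
    rw [abs_mul, abs_mul, abs_of_pos hsc, abs_of_pos (Real.exp_pos _), Real.rpow_neg h1s.le]
    calc (1 + y) ^ m * (s ^ (c - 1) * Real.exp (-s) * |c - s|)
        ≤ (1 + s) ^ m * (s ^ (c - 1) * Real.exp (-s) * ((c + 1) * (1 + s))) := by gcongr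
      _ = s ^ (c - 1) * (((1 + s) ^ m * (Real.exp (-s) * ((c + 1) * (1 + s))) *
            (1 + s) ^ (c + 1)) * ((1 + s) ^ (c + 1))⁻¹) := by
          field_simp
      _ ≤ s ^ (c - 1) * ((B * (c + 1)) * ((1 + s) ^ (c + 1))⁻¹) := by gcongr
      _ = _ := by rw [hK]; field_simp
  -- The weight is frozen at `y`; monotonicity for both signs ε = ±1 yields the absolute value.
  have hmono (ε : ℝ) (hε : |ε| = 1) : MonotoneOn
      (fun s => K * (s / (1 + s)) ^ c + ε * ((1 + y) ^ m * profile c s)) (Set.Icc y z) := by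
    have hd {s : ℝ} (hs : y ≤ s) := ((hasDerivAt_div_one_add_rpow (c := c)
      (hy.trans_le hs)).const_mul K).fun_add (((hasDerivAt_profile (c := c)
        (hy.trans_le hs)).const_mul ((1 + y) ^ m)).const_mul ε)
    refine monotoneOn_of_deriv_nonneg (convex_Icc y z)
      (fun s hs => (hd hs.1).continuousAt.continuousWithinAt)
      (fun s hs => (hd (interior_subset hs).1).differentiableAt.differentiableWithinAt)
      fun s hs => ?_
    rw [(hd (interior_subset hs).1).deriv]
    have h1 := hkey (interior_subset hs).1
    have h2 : |ε * ((1 + y) ^ m * (s ^ (c - 1) * Real.exp (-s) * (c - s)))| =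
        (1 + y) ^ m * |s ^ (c - 1) * Real.exp (-s) * (c - s)| := by
      rw [abs_mul, hε, one_mul, abs_mul, abs_of_pos (by positivity)]
    have h3 := neg_abs_le (ε * ((1 + y) ^ m * (s ^ (c - 1) * Real.exp (-s) * (c - s))))
    linarith
  have hy' : y ∈ Set.Icc y z := ⟨le_rfl, hyz⟩
  have hz' : z ∈ Set.Icc y z := ⟨hyz, le_rfl⟩
  have h1 := hmono 1 (by simp) hy' hz' hyz
  have h2 := hmono (-1) (by simp) hy' hz' hyz
  simp only at h1 h2
  rw [← abs_of_pos (by positivity : 0 < (1 + y) ^ m), ← abs_mul, abs_le]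
  constructor <;> linarith

end Estimates

/-! ### Sums over samples of the profile, uniformly in the scale δ -/

section ScaledSamples

/-- `w` samples the profile `y ^ c e^{-y}` at points `y_l` comparable to `(δ l) ^ ν`. -/
structure ScaledSamples (c k₁ k₂ W : ℝ) (ν : ℕ) (δ : ℝ) (y w : ℕ → ℝ) : Prop where
  pos : 0 < δ
  le_one : δ ≤ 1
  lower : ∀ l : ℕ, 1 ≤ l → k₁ * (δ * l) ^ ν ≤ y l
  upper : ∀ l : ℕ, 1 ≤ l → y l ≤ k₂ * (δ * l) ^ ν
  mono : ∀ l : ℕ, 1 ≤ l → y l ≤ y (l + 1)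
  zero : |w 0| ≤ W
  eq : ∀ l : ℕ, 1 ≤ l → w l = profile c (y l)

variable {c k₁ k₂ W δ : ℝ} {ν : ℕ} {y w : ℕ → ℝ}

theorem ScaledSamples.sample_pos (h : ScaledSamples c k₁ k₂ W ν δ y w) (hk : 0 < k₁) {l : ℕ}
    (hl : 1 ≤ l) : 0 < y l := by
  have h0 := h.pos
  have hl' : (0 : ℝ) < l := by exact_mod_cast hl
  exact (by positivity : 0 < k₁ * (δ * l) ^ ν).trans_le (h.lower l hl)

/-- Used to trade powers of δl, coming from the weights, for powers of 1 + y_l, which the profile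
absorbs. -/
theorem ScaledSamples.mul_le (h : ScaledSamples c k₁ k₂ W ν δ y w) (hν : 1 ≤ ν) (hk : 0 < k₁)
    {l : ℕ} (hl : 1 ≤ l) : δ * l ≤ (1 + 1 / k₁) * (1 + y l) := by
  have h0 := h.pos
  have hy := h.sample_pos hk hl
  have h1 : δ * l ≤ 1 + (δ * l) ^ ν := by
    rcases le_total (δ * l) 1 with h2 | h2
    · have : 0 ≤ (δ * l) ^ ν := by positivity
      linarith
    · linarith [le_self_pow₀ h2 (by omega : ν ≠ 0)]
  have h3 : (δ * l) ^ ν ≤ y l / k₁ := by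
    rw [le_div_iff₀ hk, mul_comm]; exact h.lower l hl
  have h4 : (1 + 1 / k₁) * (1 + y l) = 1 + y l / k₁ + (y l + 1 / k₁) := by ring
  have : 0 ≤ y l + 1 / k₁ := by positivity
  linarith

/-- One difference is bounded by the supremum of the profile and the other telescopes, since the
samples are monotone for l ≥ 1. No bound on the derivative of the profile at 0 is needed, so every c
> 0 is covered. -/
theorem exists_variation_bound {n : ℕ} (hn : 2 ≤ n) (hc : 0 < c) (hν : 1 ≤ ν) (hk₁ : 0 < k₁)
    (k₂ W : ℝ) :
    ∃ C : ℝ, 0 < C ∧ ∀ (δ : ℝ) (y w : ℕ → ℝ), ScaledSamples c k₁ k₂ W ν δ y w →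
      δ ^ (n - 1) * ∑' l, zonalWeight n l * (w l - w (l + 1)) ^ 2 ≤ C := by
  obtain ⟨B, hB, hBle⟩ := exists_one_add_pow_mul_profile_le hc 0
  obtain ⟨K, hK, hKle⟩ := exists_weighted_variation_profile hc (n - 1)
  have hG0 := gegenbauerSqNorm_zero_pos n
  set A := 2 * gegenbauerSqNorm n 0 * n ^ (n - 1) * (2 * (1 + 1 / k₁)) ^ (n - 1) with hA
  have hn0 : (0 : ℝ) < n := by exact_mod_cast (by omega : 0 < n)
  have hApos : 0 < A := by positivity
  have hW0 := zonalWeight_nonneg n 0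
  refine ⟨zonalWeight n 0 * (|W| + B) ^ 2 + A * B * K, by positivity, fun δ y w h => ?_⟩
  have h0 := h.pos
  have hprof {l : ℕ} (hl : 1 ≤ l) : 0 ≤ w l ∧ w l ≤ B := by
    have hy := h.sample_pos hk₁ hl
    rw [h.eq l hl]
    refine ⟨profile_nonneg hy.le, ?_⟩
    have := hBle (y l) hy.le
    rw [pow_zero, one_mul] at this
    refine this.trans (mul_le_of_le_one_right hB.le ?_)
    rw [Real.exp_le_one_iff]; linarith
  rw [← tsum_mul_left]
  refine tsum_le_of_telescoping
    (T := fun l => A * B * (K * (y l / (1 + y l)) ^ c)) (fun l => ?_) ?_ ?_ (fun l hl => ?_)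
    fun l hl => ?_
  · have := zonalWeight_nonneg n l
    positivity
  · have h1 := hprof (le_refl 1)
    have hd : δ ^ (n - 1) ≤ 1 := pow_le_one₀ h0.le h.le_one
    have habs : |w 0 - w 1| ≤ |W| + B := by
      have := abs_sub (w 0) (w 1)
      have h2 : |w 1| ≤ B := by rw [abs_of_nonneg h1.1]; exact h1.2
      have h3 := h.zero.trans (le_abs_self W)
      linarith
    have hsq : (w 0 - w 1) ^ 2 ≤ (|W| + B) ^ 2 := by
      rw [← sq_abs]; gcongr
    calc _ ≤ 1 * (zonalWeight n 0 * (|W| + B) ^ 2) := by gcongr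
      _ = _ := one_mul _
  · have := h.sample_pos hk₁ (le_refl 1)
    positivity
  · have hy := h.sample_pos hk₁ hl
    rw [← mul_assoc]
    refine mul_le_of_le_one_right (by positivity) (Real.rpow_le_one (by positivity) ?_ hc.le)
    rw [div_le_one (by positivity)]; linarith
  · have hy := h.sample_pos hk₁ hl
    have hl' : (1 : ℝ) ≤ l := by exact_mod_cast hl
    have hwt : δ ^ (n - 1) * zonalWeight n l ≤ A * (1 + y l) ^ (n - 1) := by
      calc δ ^ (n - 1) * zonalWeight n l
          ≤ δ ^ (n - 1) * (2 * gegenbauerSqNorm n 0 * n ^ (n - 1) * (2 * (l : ℝ)) ^ (n - 1)) := by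
            refine mul_le_mul_of_nonneg_left ((zonalWeight_le hn l).trans ?_) (by positivity)
            gcongr
            linarith
        _ = 2 * gegenbauerSqNorm n 0 * n ^ (n - 1) * (2 * (δ * l)) ^ (n - 1) := by
            rw [mul_pow, mul_pow, mul_pow]; ring
        _ ≤ 2 * gegenbauerSqNorm n 0 * n ^ (n - 1) *
              (2 * ((1 + 1 / k₁) * (1 + y l))) ^ (n - 1) := by
            have := h.mul_le hν hk₁ hl
            exact mul_le_mul_of_nonneg_left
              (pow_le_pow_left₀ (by positivity) (by linarith) _) (by positivity)
        _ = _ := by rw [hA, ← mul_assoc 2 (1 + 1 / k₁), mul_pow _ (1 + y l)]; ring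
    have hv := hKle (y l) (y (l + 1)) hy (h.mono l hl)
    rw [← h.eq l hl, ← h.eq (l + 1) (by omega)] at hv
    have hwl := hprof hl
    have hwl' := hprof (by omega : 1 ≤ l + 1)
    have hB' : |w (l + 1) - w l| ≤ B := by rw [abs_le]; constructor <;> linarith
    have hsq : (w l - w (l + 1)) ^ 2 = |w (l + 1) - w l| * |w (l + 1) - w l| := by
      rw [abs_mul_abs_self]; ring
    have hwn := zonalWeight_nonneg n l
    calc δ ^ (n - 1) * (zonalWeight n l * (w l - w (l + 1)) ^ 2)
        = (δ ^ (n - 1) * zonalWeight n l) * (|w (l + 1) - w l| * |w (l + 1) - w l|) := by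
          rw [hsq]; ring
      _ ≤ (A * (1 + y l) ^ (n - 1)) * (|w (l + 1) - w l| * B) := by gcongr
      _ = A * B * ((1 + y l) ^ (n - 1) * |w (l + 1) - w l|) := by ring
      _ ≤ A * B * (K * (y (l + 1) / (1 + y (l + 1))) ^ c - K * (y l / (1 + y l)) ^ c) := by
          gcongr
      _ = _ := by ring

theorem exists_energy_bound {n : ℕ} (hn : 2 ≤ n) (hc : 0 < c) (hν : 1 ≤ ν) (hk₁ : 0 < k₁)
    (k₂ W : ℝ) :
    ∃ C : ℝ, 0 < C ∧ ∀ (δ : ℝ) (y w : ℕ → ℝ), ScaledSamples c k₁ k₂ W ν δ y w →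
      δ ^ (n + 2) * ∑' l : ℕ, (l : ℝ) * (l + 2 * order n) * (zonalWeight n l * w l ^ 2) ≤ C := by
  -- The power n + 1 comes from eigenvalue times weight, and 2 more from the factor (1 + δl)² that
  -- makes the sum converge.
  obtain ⟨B, hB, hBle⟩ := exists_one_add_pow_mul_profile_le hc (n + 3)
  obtain ⟨B', hB', hBle'⟩ := exists_one_add_pow_mul_profile_le hc 0
  have hG0 := gegenbauerSqNorm_zero_pos n
  have ho := order_pos hn
  have hn0 : (0 : ℝ) < n := by exact_mod_cast (by omega : 0 < n)
  set Q := 1 + 1 / k₁ with hQ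
  have hQ1 : 1 ≤ Q := by have : 0 ≤ 1 / k₁ := by positivity
                         linarith
  set A := (1 + 2 * order n) * (2 * gegenbauerSqNorm n 0 * n ^ (n - 1) * 2 ^ (n - 1)) with hA
  have hApos : 0 < A := by positivity
  set D := A * Q ^ (n + 1) * (B * B') * (2 * Q) ^ 2 with hD
  have hDpos : 0 < D := by positivity
  refine ⟨0 + D, by positivity, fun δ y w h => ?_⟩
  have h0 := h.pos
  rw [← tsum_mul_left]
  -- The terms are at most Dδ/(1 + δl)². The shift to l - 1 makes this bounded by an increment of
  -- `T` and gives T 1 = 0.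
  refine tsum_le_of_telescoping
    (T := fun l => D * (1 - (1 + δ * ((l : ℝ) - 1))⁻¹)) (fun l => ?_) ?_ ?_ (fun l hl => ?_)
    fun l hl => ?_
  · have := zonalWeight_nonneg n l
    positivity
  · simp
  · simp
  · have hl' : (1 : ℝ) ≤ l := by exact_mod_cast hl
    refine mul_le_of_le_one_right hDpos.le ?_
    have : 0 ≤ (1 + δ * ((l : ℝ) - 1))⁻¹ := by
      have : 0 ≤ (l : ℝ) - 1 := by linarith
      positivity
    linarith
  · have hy := h.sample_pos hk₁ hl
    have hl' : (1 : ℝ) ≤ l := by exact_mod_cast hl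
    have hle := h.mul_le hν hk₁ hl
    have hwt : (l : ℝ) * (l + 2 * order n) * zonalWeight n l ≤ A * (l : ℝ) ^ (n + 1) := by
      have h1 : (l : ℝ) * (l + 2 * order n) ≤ (1 + 2 * order n) * (l : ℝ) ^ 2 := by
        nlinarith [mul_nonneg ho.le (mul_nonneg (sub_nonneg.mpr hl') (by positivity : (0 : ℝ) ≤ l))]
      have h2 : zonalWeight n l ≤ 2 * gegenbauerSqNorm n 0 * n ^ (n - 1) * (2 * (l : ℝ)) ^ (n - 1) := by
        refine (zonalWeight_le hn l).trans ?_
        gcongr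
        linarith
      calc _ ≤ ((1 + 2 * order n) * (l : ℝ) ^ 2) *
            (2 * gegenbauerSqNorm n 0 * n ^ (n - 1) * (2 * (l : ℝ)) ^ (n - 1)) :=
            mul_le_mul h1 h2 (zonalWeight_nonneg n l) (by positivity)
        _ = _ := by
            rw [hA, show n + 1 = (n - 1) + 2 by omega, pow_add, mul_pow 2 (l : ℝ)]
            ring
    have hp1 := hBle (y l) hy.le
    have hp2 := hBle' (y l) hy.le
    have hexp : Real.exp (-(1 / 2 * y l)) ≤ 1 := by rw [Real.exp_le_one_iff]; linarith
    rw [← h.eq l hl] at hp1 hp2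
    rw [pow_zero, one_mul] at hp2
    have hw0 : 0 ≤ w l := by rw [h.eq l hl]; exact profile_nonneg hy.le
    have hp1' : (1 + y l) ^ (n + 3) * w l ≤ B := hp1.trans (mul_le_of_le_one_right hB.le hexp)
    have hp2' : w l ≤ B' := hp2.trans (mul_le_of_le_one_right hB'.le hexp)
    have hden : 1 + δ * l ≤ 2 * Q * (1 + y l) := by nlinarith
    have hmain : (1 + δ * l) ^ 2 * (δ ^ (n + 1) *
        ((l : ℝ) * (l + 2 * order n) * (zonalWeight n l * w l ^ 2))) ≤ D := by
      calc (1 + δ * l) ^ 2 * (δ ^ (n + 1) *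
            ((l : ℝ) * (l + 2 * order n) * (zonalWeight n l * w l ^ 2)))
          = (1 + δ * l) ^ 2 * (δ ^ (n + 1) *
              ((l : ℝ) * (l + 2 * order n) * zonalWeight n l)) * w l ^ 2 := by ring
        _ ≤ (2 * Q * (1 + y l)) ^ 2 * (δ ^ (n + 1) * (A * (l : ℝ) ^ (n + 1))) * w l ^ 2 := by
            have := zonalWeight_nonneg n l
            gcongr
        _ = (2 * Q * (1 + y l)) ^ 2 * (A * (δ * l) ^ (n + 1)) * w l ^ 2 := by
            rw [mul_pow δ]; ring
        _ ≤ (2 * Q * (1 + y l)) ^ 2 * (A * (Q * (1 + y l)) ^ (n + 1)) * w l ^ 2 := by gcongr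
        _ = A * Q ^ (n + 1) * (2 * Q) ^ 2 * (((1 + y l) ^ (n + 3) * w l) * w l) := by
            rw [mul_pow, mul_pow Q (1 + y l), show n + 3 = (n + 1) + 2 by omega, pow_add _ (n + 1) 2]
            ring
        _ ≤ A * Q ^ (n + 1) * (2 * Q) ^ 2 * (B * B') := by gcongr
        _ = D := by rw [hD]; ring
    have hpos1 : 0 < 1 + δ * ((l : ℝ) - 1) := by
      have : 0 ≤ (l : ℝ) - 1 := by linarith
      positivity
    have hpos2 : 0 < 1 + δ * (l : ℝ) := by positivity
    have htel : δ * ((1 + δ * l) ^ 2)⁻¹ ≤ (1 + δ * ((l : ℝ) - 1))⁻¹ - (1 + δ * (l : ℝ))⁻¹ := by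
      have e : (1 + δ * ((l : ℝ) - 1))⁻¹ - (1 + δ * (l : ℝ))⁻¹ =
          δ * ((1 + δ * ((l : ℝ) - 1)) * (1 + δ * l))⁻¹ := by
        field_simp; ring
      rw [e, sq]
      gcongr
      linarith
    rw [← le_div_iff₀' (by positivity), div_eq_mul_inv] at hmain
    calc δ ^ (n + 2) * ((l : ℝ) * (l + 2 * order n) * (zonalWeight n l * w l ^ 2))
        = δ * (δ ^ (n + 1) * ((l : ℝ) * (l + 2 * order n) * (zonalWeight n l * w l ^ 2))) := by ring
      _ ≤ δ * (D * ((1 + δ * l) ^ 2)⁻¹) := by gcongr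
      _ = D * (δ * ((1 + δ * l) ^ 2)⁻¹) := by ring
      _ ≤ D * ((1 + δ * ((l : ℝ) - 1))⁻¹ - (1 + δ * (l : ℝ))⁻¹) := by gcongr
      _ = _ := by push_cast; ring_nf

/-- The indices N ≤ l < 2N with N = ⌈1/δ⌉ suffice: there 1 ≤ δl ≤ 4, so y_l lies in [k₁, k₂4^ν] and
w_l ≥ p, while the weights are at least of order N^{n-1}. -/
theorem exists_mass_bound {n : ℕ} (hn : 2 ≤ n) (hc : 0 < c) (hk₁ : 0 < k₁) (hk₂ : 0 < k₂)
    (ν : ℕ) (W : ℝ) :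
    ∃ C : ℝ, 0 < C ∧ ∀ (δ : ℝ) (y w : ℕ → ℝ), ScaledSamples c k₁ k₂ W ν δ y w →
      ∀ S, HasSum (fun l => zonalWeight n l * (w l ^ 2 + w (l + 1) ^ 2) / 2) S → C ≤ δ ^ n * S := by
  have hG0 := gegenbauerSqNorm_zero_pos n
  set A := 2 * gegenbauerSqNorm n 0 / ((n - 1).factorial : ℝ) with hA
  set p := k₁ ^ c * Real.exp (-(k₂ * 4 ^ ν)) with hp
  have hp0 : 0 < p := by positivity
  have hA0 : 0 < A := by positivity
  refine ⟨A * p ^ 2 / 2, by positivity, fun δ y w h S hS => ?_⟩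
  have h0 := h.pos
  have h1 := h.le_one
  set N := ⌈1 / δ⌉₊ with hN
  have hN1 : 1 / δ ≤ N := Nat.le_ceil _
  have hN2 : (N : ℝ) < 1 / δ + 1 := Nat.ceil_lt_add_one (by positivity)
  have hδN : 1 ≤ δ * N := by
    rw [div_le_iff₀ h0] at hN1; linarith
  have hδN2 : δ * N ≤ 2 := by
    have : δ * N ≤ δ * (1 / δ + 1) := by gcongr
    rw [mul_add, mul_one_div_cancel h0.ne'] at this
    linarith
  have hterm (l : ℕ) (hl : l ∈ Finset.Ico N (2 * N)) :
      A * (N : ℝ) ^ (n - 1) * p ^ 2 / 2 ≤ zonalWeight n l * (w l ^ 2 + w (l + 1) ^ 2) / 2 := by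
    obtain ⟨hl1, hl2⟩ := Finset.mem_Ico.mp hl
    have hNpos : 0 < N := Nat.ceil_pos.mpr (by positivity)
    have hl0 : 1 ≤ l := by omega
    have hlN : (N : ℝ) ≤ l := by exact_mod_cast hl1
    have hlN2 : (l : ℝ) ≤ 2 * N := by exact_mod_cast hl2.le
    have hx1 : 1 ≤ δ * l := hδN.trans (by gcongr)
    have hx2 : δ * l ≤ 4 := by nlinarith
    have hy1 : k₁ ≤ y l :=
      (le_mul_of_one_le_right hk₁.le (one_le_pow₀ hx1)).trans (h.lower l hl0)
    have hy2 : y l ≤ k₂ * 4 ^ ν := (h.upper l hl0).trans (by gcongr)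
    have hw : p ≤ w l := by
      have : 0 ≤ y l ^ c := Real.rpow_nonneg (hk₁.le.trans hy1) c
      rw [h.eq l hl0, profile, hp]
      gcongr
    have hz : A * (N : ℝ) ^ (n - 1) ≤ zonalWeight n l := by
      refine le_trans ?_ (le_zonalWeight hn l)
      gcongr
    have hw2 : p ^ 2 ≤ w l ^ 2 + w (l + 1) ^ 2 := by
      have : p ^ 2 ≤ w l ^ 2 := by gcongr
      nlinarith [sq_nonneg (w (l + 1))]
    have := zonalWeight_nonneg n l
    gcongr
  have hsum : ∑ _l ∈ Finset.Ico N (2 * N), A * (N : ℝ) ^ (n - 1) * p ^ 2 / 2 ≤ S := by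
    refine (Finset.sum_le_sum hterm).trans (sum_le_hasSum _ (fun l _ => ?_) hS)
    have := zonalWeight_nonneg n l
    positivity
  rw [Finset.sum_const, Nat.card_Ico, nsmul_eq_mul, show 2 * N - N = N by omega] at hsum
  have hpow : (N : ℝ) * N ^ (n - 1) = N ^ n := by
    rw [← pow_succ', Nat.sub_add_cancel (by omega)]
  calc A * p ^ 2 / 2 ≤ (δ * N) ^ n * (A * p ^ 2 / 2) :=
        le_mul_of_one_le_left (by positivity) (one_le_pow₀ hδN)
    _ = δ ^ n * (N * (A * (N : ℝ) ^ (n - 1) * p ^ 2 / 2)) := by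
        rw [mul_pow, ← hpow]; ring
    _ ≤ δ ^ n * S := by gcongr

end ScaledSamples

/-! ### Application to the wavelets -/

section Wavelet

/-- The coefficients of the wavelet with respect to the kernels `(l + λ) / λ * C_l^λ`. -/
def waveletSeq (a c : ℝ) (q : Polynomial ℝ) (ρ : ℝ) (l : ℕ) : ℝ :=
  profile c (ρ ^ a * q.eval (l : ℝ))

theorem waveletTerm_eq (n : ℕ) (a c : ℝ) (q : Polynomial ℝ) (ρ : ℝ) (x : Sph n) (l : ℕ) :
    waveletTerm n a c q ρ x l = scaledCoeff n (waveletSeq a c q ρ) l *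
      (gegenbauerPoly (order n) l).eval ((x : Ambient n) 0) := by
  rw [waveletTerm, gegenbauer_eq_eval]; rfl

theorem wavelet_eq (n : ℕ) (a c : ℝ) (q : Polynomial ℝ) (ρ : ℝ) :
    wavelet n a c q ρ = zonalSeries n (scaledCoeff n (waveletSeq a c q ρ)) := by
  funext x
  simp only [wavelet, zonalSeries, gegenbauerSeries, waveletTerm_eq]

theorem geometricDecay_waveletSeq {a c : ℝ} (hc : 0 < c) {ν : ℕ} (hν : 1 ≤ ν) {q : Polynomial ℝ}
    (hdeg : q.natDegree = ν) (hpos : ∀ l : ℕ, 1 ≤ l → 0 < q.eval (l : ℝ)) {ρ : ℝ} (hρ : 0 < ρ) :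
    GeometricDecay (waveletSeq a c q ρ) := by
  obtain ⟨k₁, k₂, hk₁, hk₂, hq⟩ := exists_eval_bounds hν hdeg hpos
  obtain ⟨B, hB, hBle⟩ := exists_one_add_pow_mul_profile_le hc 0
  have hr : 0 < ρ ^ a := Real.rpow_pos_of_pos hρ a
  refine ⟨B + |waveletSeq a c q ρ 0|, Real.exp (-(1 / 2 * (ρ ^ a * k₁))), Real.exp_pos _,
    ?_, fun l => ?_⟩
  · rw [Real.exp_lt_one_iff]
    have : 0 < 1 / 2 * (ρ ^ a * k₁) := by positivity
    linarith
  · rcases Nat.eq_zero_or_pos l with rfl | hl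
    · rw [pow_zero, mul_one]; linarith
    · have hy : 0 < ρ ^ a * q.eval (l : ℝ) := mul_pos hr (hpos l hl)
      have hl' : (1 : ℝ) ≤ l := by exact_mod_cast hl
      have h1 := hBle _ hy.le
      rw [pow_zero, one_mul] at h1
      have h2 : k₁ * l ≤ q.eval (l : ℝ) := by
        refine le_trans ?_ (hq l hl).1
        gcongr
        exact le_self_pow₀ hl' (by omega)
      rw [waveletSeq, abs_of_nonneg (profile_nonneg hy.le), ← Real.exp_nat_mul]
      refine h1.trans ?_
      have h3 : Real.exp (-(1 / 2 * (ρ ^ a * q.eval (l : ℝ)))) ≤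
          Real.exp (l * -(1 / 2 * (ρ ^ a * k₁))) := by
        rw [Real.exp_le_exp]
        have := mul_le_mul_of_nonneg_left h2 hr.le
        linarith
      have := abs_nonneg (waveletSeq a c q ρ 0)
      gcongr
      linarith

theorem scaledSamples_waveletSeq {a c : ℝ} (ha : 0 < a) (hc : 0 < c) {ν : ℕ} (hν : 1 ≤ ν)
    {q : Polynomial ℝ} (hmono : ∀ l m : ℕ, 1 ≤ l → l ≤ m → q.eval (l : ℝ) ≤ q.eval (m : ℝ))
    {k₁ k₂ : ℝ} (hq : ∀ l : ℕ, 1 ≤ l →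
      k₁ * (l : ℝ) ^ ν ≤ q.eval (l : ℝ) ∧ q.eval (l : ℝ) ≤ k₂ * (l : ℝ) ^ ν)
    {ρ : ℝ} (hρ : 0 < ρ) (hρ1 : ρ ≤ 1) :
    ScaledSamples c k₁ k₂ (|q.eval 0| ^ c * Real.exp |q.eval 0|) ν (ρ ^ (a / (ν : ℝ)))
      (fun l => ρ ^ a * q.eval (l : ℝ)) (waveletSeq a c q ρ) := by
  have hr : 0 < ρ ^ a := Real.rpow_pos_of_pos hρ a
  have hr1 : ρ ^ a ≤ 1 := Real.rpow_le_one hρ.le hρ1 ha.le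
  have hν0 : (ν : ℝ) ≠ 0 := by exact_mod_cast (by omega : ν ≠ 0)
  have hδ : (ρ ^ (a / (ν : ℝ))) ^ ν = ρ ^ a := by
    rw [← Real.rpow_natCast, ← Real.rpow_mul hρ.le, div_mul_cancel₀ _ hν0]
  refine ⟨Real.rpow_pos_of_pos hρ _, Real.rpow_le_one hρ.le hρ1 (by positivity),
    fun l hl => ?_, fun l hl => ?_, fun l hl => ?_, ?_, fun l _ => rfl⟩
  · rw [mul_pow, hδ]
    nlinarith [(hq l hl).1]
  · rw [mul_pow, hδ]
    nlinarith [(hq l hl).2]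
  · exact mul_le_mul_of_nonneg_left (hmono l (l + 1) hl (by omega)) hr.le
  -- At l = 0 the polynomial may be negative or zero. The real power of a number y is still at most
  -- |y|^c in absolute value, and ρ^a ≤ 1 makes the bound uniform.
  · have habs : |ρ ^ a * q.eval 0| ≤ |q.eval 0| := by
      rw [abs_mul, abs_of_pos hr]
      exact mul_le_of_le_one_left (abs_nonneg _) hr1
    rw [waveletSeq, profile, abs_mul, abs_of_pos (Real.exp_pos _), Nat.cast_zero]
    have h1 : |(ρ ^ a * q.eval 0) ^ c| ≤ |q.eval 0| ^ c :=
      (Real.abs_rpow_le_abs_rpow _ _).trans (Real.rpow_le_rpow (abs_nonneg _) habs hc.le)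
    have h2 : Real.exp (-(ρ ^ a * q.eval 0)) ≤ Real.exp |q.eval 0| := by
      rw [Real.exp_le_exp]
      exact (neg_le_abs _).trans habs
    exact mul_le_mul h1 h2 (Real.exp_pos _).le (by positivity)

theorem norm_firstMoment_bounds {n : ℕ} {f : Sph n → ℝ} (hf : Continuous f) :
    ∫ x : Sph n, |f x| ^ 2 * (x : Ambient n) 0 ∂(surf n) ≤ ‖firstMoment f‖ ∧
      ‖firstMoment f‖ ≤ ∫ x, |f x| ^ 2 ∂(surf n) := by
  have hint : Integrable (fun x : Sph n => |f x| ^ 2 • (x : Ambient n)) (surf n) :=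
    integrable_of_continuous_sphere ((hf.abs.pow 2).smul continuous_subtype_val)
  constructor
  · have h : ∫ x : Sph n, |f x| ^ 2 * (x : Ambient n) 0 ∂(surf n) = firstMoment f 0 :=
      (EuclideanSpace.proj (𝕜 := ℝ) (0 : Fin (n + 1))).integral_comp_comm hint
    rw [h]
    exact (le_abs_self _).trans (PiLp.norm_apply_le (firstMoment f) 0)
  · refine (norm_integral_le_integral_norm _).trans_eq ?_
    refine integral_congr_ae (ae_of_all _ fun x => ?_)
    simp only [norm_smul, norm_eq_of_mem_sphere x, mul_one]
    exact Real.norm_of_nonneg (by positivity)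

/-- Uniform bounds, in terms of `δ = ρ ^ (a / ν)`, for the mass, the defect of the first moment
and the energy of the wavelets. -/
theorem exists_wavelet_bounds {n : ℕ} (hn : 2 ≤ n) {a c : ℝ} (ha : 0 < a) (hc : 0 < c)
    {ν : ℕ} (hν : 1 ≤ ν) {q : Polynomial ℝ} (hdeg : q.natDegree = ν)
    (hpos : ∀ l : ℕ, 1 ≤ l → 0 < q.eval (l : ℝ))
    (hmono : ∀ l m : ℕ, 1 ≤ l → l ≤ m → q.eval (l : ℝ) ≤ q.eval (m : ℝ)) :
    ∃ K : ℝ, 0 < K ∧ ∀ ρ : ℝ, 0 < ρ → ρ ≤ 1 →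
      0 < ∫ x, |wavelet n a c q ρ x| ^ 2 ∂(surf n) ∧
      (1 - K * ρ ^ (a / (ν : ℝ))) * ∫ x, |wavelet n a c q ρ x| ^ 2 ∂(surf n) ≤
        ∫ x : Sph n, |wavelet n a c q ρ x| ^ 2 * (x : Ambient n) 0 ∂(surf n) ∧
      0 ≤ varM (wavelet n a c q ρ) ∧
      varM (wavelet n a c q ρ) ≤ K * ((ρ ^ (a / (ν : ℝ))) ^ 2)⁻¹ := by
  obtain ⟨k₁, k₂, hk₁, hk₂, hq⟩ := exists_eval_bounds hν hdeg hpos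
  set W := |q.eval 0| ^ c * Real.exp |q.eval 0|
  obtain ⟨C₁, hC₁, hvar⟩ := exists_variation_bound hn hc hν hk₁ k₂ W
  obtain ⟨C₂, hC₂, hen⟩ := exists_energy_bound hn hc hν hk₁ k₂ W
  obtain ⟨C₀, hC₀, hmass⟩ := exists_mass_bound hn hc hk₁ hk₂ ν W
  refine ⟨max (C₁ / C₀) (C₂ / C₀), lt_max_of_lt_left (by positivity), fun ρ hρ hρ1 => ?_⟩
  have hS := scaledSamples_waveletSeq ha hc hν hmono hq hρ hρ1
  have hw := geometricDecay_waveletSeq (a := a) hc hν hdeg hpos hρ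
  have hI := hasSum_integral_sq_zonalSeries hn hw
  have hM := hasSum_integral_coord_mul_sq_zonalSeries hn hw
  have hV := integral_laplaceBeltrami_mul_zonalSeries_bounds hn hw
  rw [varM]
  rw [← wavelet_eq] at hI hM hV
  set f := wavelet n a c q ρ
  set w := waveletSeq a c q ρ
  set δ := ρ ^ (a / (ν : ℝ))
  have hδ : 0 < δ := hS.pos
  have h0 := hmass _ _ _ hS _ hI
  have h1 := hvar _ _ _ hS
  have h2 := hen _ _ _ hS
  set I := ∫ x, |f x| ^ 2 ∂(surf n)
  set M := ∫ x : Sph n, |f x| ^ 2 * (x : Ambient n) 0 ∂(surf n)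
  set V := ∫ x, laplaceBeltrami f x * f x ∂(surf n)
  have hIpos : 0 < I := pos_of_mul_pos_right (hC₀.trans_le h0) (by positivity)
  -- Termwise (w_l² + w_{l+1}²)/2 - w_l w_{l+1} is half a square.
  have hdiff : I - M = (∑' l, zonalWeight n l * (w l - w (l + 1)) ^ 2) / 2 := by
    rw [← (hI.sub hM).tsum_eq, ← tsum_div_const]
    exact tsum_congr fun l => by ring
  have hD0 : 0 ≤ ∑' l, zonalWeight n l * (w l - w (l + 1)) ^ 2 :=
    tsum_nonneg fun l => mul_nonneg (zonalWeight_nonneg n l) (sq_nonneg _)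
  have hdiff' : I - M ≤ C₁ / C₀ * δ * I := by
    have e : δ ^ n = δ * δ ^ (n - 1) := by rw [← pow_succ', Nat.sub_add_cancel (by omega)]
    rw [div_mul_eq_mul_div, div_mul_eq_mul_div, le_div_iff₀ hC₀]
    refine le_of_mul_le_mul_left ?_ (by positivity : 0 < δ ^ (n - 1))
    have h3 : δ ^ (n - 1) * (I - M) ≤ C₁ := by
      refine le_trans ?_ h1
      rw [hdiff]
      gcongr
      linarith
    have hIM : 0 ≤ I - M := by rw [hdiff]; positivity
    calc δ ^ (n - 1) * ((I - M) * C₀) = (δ ^ (n - 1) * (I - M)) * C₀ := by ring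
      _ ≤ C₁ * (δ ^ n * I) := mul_le_mul h3 h0 hC₀.le hC₁.le
      _ = _ := by rw [e]; ring
  refine ⟨hIpos, ?_, ?_, ?_⟩
  · have : C₁ / C₀ * δ * I ≤ max (C₁ / C₀) (C₂ / C₀) * δ * I := by
      gcongr
      exact le_max_left _ _
    linarith
  · rw [← neg_div]
    exact div_nonneg hV.1 hIpos.le
  · have h3 : -V * C₀ ≤ C₂ * (δ ^ 2)⁻¹ * I := by
      refine le_of_mul_le_mul_left ?_ (by positivity : 0 < δ ^ (n + 2))
      have h4 : δ ^ (n + 2) * -V ≤ C₂ :=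
        le_trans (mul_le_mul_of_nonneg_left hV.2 (by positivity)) h2
      calc δ ^ (n + 2) * (-V * C₀) = (δ ^ (n + 2) * -V) * C₀ := by ring
        _ ≤ C₂ * (δ ^ n * I) := mul_le_mul h4 h0 hC₀.le hC₂.le
        _ = _ := by rw [pow_add]; field_simp
    rw [← neg_div, div_le_iff₀ hIpos]
    calc -V ≤ C₂ / C₀ * (δ ^ 2)⁻¹ * I := by
          rw [div_mul_eq_mul_div, div_mul_eq_mul_div, le_div_iff₀ hC₀]; exact h3
      _ ≤ _ := by gcongr; exact le_max_right _ _

/-- A first moment close to the mass forces a small space variance. -/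
theorem varS_bounds {n : ℕ} {f : Sph n → ℝ} {ε : ℝ} (hε0 : 0 ≤ ε) (hε : ε ≤ 1 / 2)
    (hI : 0 < ∫ x, |f x| ^ 2 ∂(surf n))
    (hlow : (1 - ε) * ∫ x, |f x| ^ 2 ∂(surf n) ≤ ‖firstMoment f‖)
    (hup : ‖firstMoment f‖ ≤ ∫ x, |f x| ^ 2 ∂(surf n)) :
    firstMoment f ≠ 0 ∧ 0 ≤ varS f ∧ varS f ≤ 8 * ε := by
  rw [varS]
  set I := ∫ x, |f x| ^ 2 ∂(surf n)
  have hm : 0 < ‖firstMoment f‖ := (mul_pos (by linarith) hI).trans_le hlow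
  refine ⟨norm_pos_iff.mp hm, ?_, ?_⟩
  · have : 1 ≤ I / ‖firstMoment f‖ := (one_le_div hm).mpr hup
    nlinarith
  · have h1 : I / ‖firstMoment f‖ ≤ 1 + 2 * ε := by
      rw [div_le_iff₀ hm]
      -- The excess over 1 is ε(1 - 2ε), which is where ε ≤ 1/2 enters.
      have h2 : 1 ≤ (1 + 2 * ε) * (1 - ε) := by nlinarith
      calc I ≤ (1 + 2 * ε) * (1 - ε) * I := le_mul_of_one_le_left hI.le h2
        _ = (1 + 2 * ε) * ((1 - ε) * I) := by ring
        _ ≤ _ := by gcongr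
    have h0 : 0 ≤ I / ‖firstMoment f‖ := by positivity
    nlinarith

end Wavelet

end SphericalWavelet

end

/-! ### The theorem -/

theorem mainTheorem1 (n : ℕ) (hn : 2 ≤ n) (a c : ℝ) (ha : 0 < a) (hc : 0 < c)
    (ν : ℕ) (hν : 1 ≤ ν) (q : Polynomial ℝ) (hdeg : q.natDegree = ν)
    (hpos : ∀ l : ℕ, 1 ≤ l → 0 < q.eval (l : ℝ))
    (hmono : ∀ l m : ℕ, 1 ≤ l → l ≤ m → q.eval (l : ℝ) ≤ q.eval (m : ℝ)) :
    -- the wavelets are well defined, twice continuously differentiable functions on the sphere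
    (∀ ρ : ℝ, 0 < ρ →
      (∀ x : SphericalWavelet.Sph n, Summable (SphericalWavelet.waveletTerm n a c q ρ x)) ∧
      ContMDiff (𝓡 n) 𝓘(ℝ, ℝ) 2 (SphericalWavelet.wavelet n a c q ρ)) ∧
    -- the variances are defined for all small scales
    (∀ᶠ ρ : ℝ in 𝓝[>] 0,
      SphericalWavelet.firstMoment (SphericalWavelet.wavelet n a c q ρ) ≠ 0) ∧
    (fun ρ : ℝ => SphericalWavelet.varS (SphericalWavelet.wavelet n a c q ρ))
      =O[𝓝[>] 0] (fun ρ : ℝ => ρ ^ (a / (ν : ℝ))) ∧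
    (fun ρ : ℝ => SphericalWavelet.varM (SphericalWavelet.wavelet n a c q ρ))
      =O[𝓝[>] 0] (fun ρ : ℝ => ρ ^ (-(2 * a) / (ν : ℝ))) ∧
    (fun ρ : ℝ => SphericalWavelet.uncertaintyProduct (SphericalWavelet.wavelet n a c q ρ))
      =O[𝓝[>] 0] (fun ρ : ℝ => ρ ^ (-a / (2 * (ν : ℝ)))) := by
  obtain ⟨K, hK, hbd⟩ := SphericalWavelet.exists_wavelet_bounds hn ha hc hν hdeg hpos hmono
  have hdecay (ρ : ℝ) (hρ : 0 < ρ) := SphericalWavelet.geometricDecay_waveletSeq (a := a) hc hν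
    hdeg hpos hρ
  have hν0 : (0 : ℝ) < ν := by exact_mod_cast (by omega : 0 < ν)
  have hcont (ρ : ℝ) (hρ : 0 < ρ) :
      ContMDiff (𝓡 n) 𝓘(ℝ, ℝ) 2 (SphericalWavelet.wavelet n a c q ρ) := by
    rw [SphericalWavelet.wavelet_eq]
    exact SphericalWavelet.contMDiff_zonalSeries hn ((hdecay ρ hρ).scaledCoeff hn)
  have htend : Tendsto (fun ρ : ℝ => K * ρ ^ (a / (ν : ℝ))) (𝓝[>] 0) (𝓝 0) := by
    have h := (Real.continuousAt_rpow_const (0 : ℝ) (a / (ν : ℝ)) (Or.inr (by positivity))).tendsto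
    rw [Real.zero_rpow (by positivity)] at h
    simpa using (h.mono_left nhdsWithin_le_nhds).const_mul K
  have hsmall : ∀ᶠ ρ : ℝ in 𝓝[>] 0, 0 < ρ ∧
      SphericalWavelet.firstMoment (SphericalWavelet.wavelet n a c q ρ) ≠ 0 ∧
      0 ≤ SphericalWavelet.varS (SphericalWavelet.wavelet n a c q ρ) ∧
      SphericalWavelet.varS (SphericalWavelet.wavelet n a c q ρ) ≤ 8 * (K * ρ ^ (a / (ν : ℝ))) ∧
      0 ≤ SphericalWavelet.varM (SphericalWavelet.wavelet n a c q ρ) ∧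
      SphericalWavelet.varM (SphericalWavelet.wavelet n a c q ρ) ≤
        K * ρ ^ (-(2 * a) / (ν : ℝ)) := by
    -- Smallness means Kδ ≤ 1/2, for `varS_bounds`, and ρ ≤ 1, for the uniform bounds.
    filter_upwards [self_mem_nhdsWithin, htend.eventually (ge_mem_nhds (one_half_pos (α := ℝ))),
      mem_nhdsWithin_of_mem_nhds (Iic_mem_nhds (one_pos (α := ℝ)))] with ρ hρ hρK hρ1
    have hρ0 : 0 < ρ := hρ
    obtain ⟨h1, h2, h3, h4⟩ := hbd ρ hρ0 hρ1
    obtain ⟨h5, h6⟩ := SphericalWavelet.norm_firstMoment_bounds (hcont ρ hρ0).continuous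
    obtain ⟨h7, h8, h9⟩ := SphericalWavelet.varS_bounds (by positivity) hρK h1 (h2.trans h5) h6
    refine ⟨hρ0, h7, h8, h9, h3, ?_⟩
    have e : ((ρ ^ (a / (ν : ℝ))) ^ 2)⁻¹ = ρ ^ (-(2 * a) / (ν : ℝ)) := by
      rw [← Real.rpow_natCast, ← Real.rpow_mul hρ0.le, ← Real.rpow_neg hρ0.le]
      congr 1
      push_cast
      ring
    rwa [e] at h4
  refine ⟨fun ρ hρ => ⟨fun x => ?_, hcont ρ hρ⟩, hsmall.mono fun ρ h => h.2.1, ?_, ?_, ?_⟩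
  · have h := SphericalWavelet.hasSum_gegenbauerSeries (SphericalWavelet.order_pos hn).le
      ((hdecay ρ hρ).scaledCoeff hn) (SphericalWavelet.abs_coord_le_one x)
    exact h.summable.congr fun l =>
      (SphericalWavelet.waveletTerm_eq n a c q ρ x l).symm
  · refine IsBigO.of_bound (8 * K) (hsmall.mono fun ρ h => ?_)
    obtain ⟨hρ, -, h1, h2, -, -⟩ := h
    rw [Real.norm_of_nonneg h1, Real.norm_of_nonneg (by positivity)]
    linarith
  · refine IsBigO.of_bound K (hsmall.mono fun ρ h => ?_)
    obtain ⟨hρ, -, -, -, h1, h2⟩ := h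
    rwa [Real.norm_of_nonneg h1, Real.norm_of_nonneg (by positivity)]
  · refine IsBigO.of_bound (√(8 * K) * √K) (hsmall.mono fun ρ h => ?_)
    obtain ⟨hρ, -, -, h1, -, h2⟩ := h
    rw [SphericalWavelet.uncertaintyProduct, Real.norm_of_nonneg (by positivity),
      Real.norm_of_nonneg (by positivity)]
    -- The exponents add up as a/(2ν) - a/ν = -a/(2ν).
    have e : ρ ^ (-a / (2 * (ν : ℝ))) = √(ρ ^ (a / (ν : ℝ))) * √(ρ ^ (-(2 * a) / (ν : ℝ))) := by
      rw [Real.sqrt_eq_rpow, Real.sqrt_eq_rpow, ← Real.rpow_mul hρ.le, ← Real.rpow_mul hρ.le,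
        ← Real.rpow_add hρ]
      congr 1
      field_simp
      ring
    calc _ ≤ √(8 * (K * ρ ^ (a / (ν : ℝ)))) * √(K * ρ ^ (-(2 * a) / (ν : ℝ))) := by gcongr
      _ = _ := by
        rw [← mul_assoc, Real.sqrt_mul (by positivity), Real.sqrt_mul hK.le, e]
        ring
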